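/- **Theorem (Non-local generalized contracted Bianchi identities).** Let $\Omega\subseteq\mathbb{R}^4$ be open (a coordinate region of a 4-dimensional spacetime, with coordinates $x^0=t,x^1,x^2,x^3$), and let $g_{\mu\nu}$ be a smooth Lorentzian metric on $\Omega$ with inverse $g^{\mu\nu}$, Levi-Civita connection $\nabla$, Ricci tensor $R_{\mu\nu}=R^{\alpha}{}_{\mu\alpha\nu}$ (where $[\nabla_\mu,\nabla_\nu]A^\gamma=R^\gamma{}_{\lambda\mu\nu}A^\lambda$), scalar curvature $R$, Einstein tensor $G_{\mu\nu}=R_{\mu\nu}-\tfrac12 g_{\mu\nu}R$ and d'Alembert operator $$\Box=\nabla^\mu\nabla_\mu=\frac{1}{\sqrt{-g}}\,\partial_\sigma\bigl(\sqrt{-g}\,g^{\sigma\lambda}\partial_\lambda\bigr).$$ Let $G(x,x')$ be a retarded Green function of $\Box$ on $\Omega$: for every $x'\in\Omega$, $G(\cdot,x')$ is a distribution on $\Omega$ with $\sqrt{-g(x)}\,\Box_xG(x,x')=\delta^4(x-x')$ and $G(x,x')=0$ for $t<t'$. For a function $p$ on $\Omega$ write $u=\Box^{-1}p$ if $u$ is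 a smooth function on $\Omega$ and $$u(x)=\int_\Omega d^4x'\,\sqrt{-g(x')}\,G(x,x')\,p(x')$$ in the sense of distributions in $x$; that is, for every test function $h\in C_c^\infty(\Omega)$, with $\langle\cdot,\cdot\rangle$ the distributional pairing in $d^4x$, the function $x'\mapsto\sqrt{-g(x')}\,\langle G(\cdot,x'),h\rangle\,p(x')$ is integrable on $\Omega$ and its integral equals $\int_\Omega u\,h\,d^4x$. Suppose that $\Box^{-1}R$ exists in this sense, that $f$ is a real function which is analytic at every value of $\Box^{-1}R$ on $\Omega$, and that $\Box^{-1}[Rf']$ exists, where $f=f(\Box^{-1}R)$ and $f'=f'(\Box^{-1}R)$. Let $$\Delta G_{\mu\nu}=\bigl(G_{\mu\nu}+g_{\mu\nu}\Box-\nabla_\mu\nabla_\nu\bigr)\bigl[f+\Box^{-1}[Rf']\bigr]+\Bigl[\delta_\mu^{(\sigma}\delta_\nu^{\lambda)}-\tfrac12 g_{\mu\nu}g^{\sigma\lambda}\Bigr]\partial_\sigma\bigl(\Box^{-1}[Rf']\bigr)\,\partial_\lambda\bigl(\Box^{-1}R\bigr),$$ with $\delta_\mu^{(\sigma}\delta_\nu^{\lambda)}=\tfrac12(\delta_\mu^\sigma\delta_\nu^\lambda+\delta_\mu^\lambda\delta_\nu^\sigma)$;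 this is the correction to the Einstein tensor in the field equations of the action $\frac1{2\chi}\int d^4x\,\sqrt{-g}\,\bigl(R+Rf(\Box^{-1}R)\bigr)$. Then on $\Omega$ $$\nabla^\mu\bigl(G_{\mu\nu}+\Delta G_{\mu\nu}\bigr)=0 .$$ Consequently, if a tensor field $T_{\mu\nu}$ (in particular the energy-momentum tensor of matter) satisfies the field equations $G_{\mu\nu}+\Delta G_{\mu\nu}=\chi T_{\mu\nu}$ on $\Omega$ with a constant $\chi\neq0$, then $\nabla_\mu T^{\mu\nu}=0$ on $\Omega$. -/

import Mathlib

open TopologicalSpace MeasureTheory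
open scoped Distributions ContDiff Topology

namespace NonlocalGravity

noncomputable section

/-- Coordinates `(x⁰, x¹, x², x³)` on `ℝ⁴`; `x⁰ = t` is the time coordinate. -/
abbrev Coord : Type := Fin 4 → ℝ

/-- The partial derivative `∂_μ F`. -/
def pd (μ : Fin 4) (F : Coord → ℝ) (x : Coord) : ℝ :=
  fderiv ℝ F x (Pi.single μ 1)

/-- A smooth Lorentzian metric on the coordinate region `Ω ⊆ ℝ⁴`, given by its components
`g_{μν}`.  Both signature conventions `(-,+,+,+)` and `(+,-,-,-)` are admitted. -/
structure LorentzMetric (Ω : Opens Coord) where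
  /-- the components `g_{μν}(x)` -/
  comp : Coord → Matrix (Fin 4) (Fin 4) ℝ
  smooth : ∀ μ ν, ContDiffOn ℝ ∞ (fun x => comp x μ ν) Ω
  symm : ∀ x ∈ Ω, (comp x).IsSymm
  lorentzian : ∀ x ∈ Ω, ∃ P : Matrix (Fin 4) (Fin 4) ℝ, IsUnit P.det ∧
    (P.transpose * comp x * P = Matrix.diagonal ![-1, 1, 1, 1] ∨
      P.transpose * comp x * P = Matrix.diagonal ![1, -1, -1, -1])

namespace LorentzMetric

variable {Ω : Opens Coord} (g : LorentzMetric Ω)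

/-- `g_{μν}` -/
def lo (μ ν : Fin 4) (x : Coord) : ℝ := g.comp x μ ν

/-- the inverse metric `g^{μν}` -/
def up (μ ν : Fin 4) (x : Coord) : ℝ := (g.comp x)⁻¹ μ ν

/-- `√(-g)`, where `g` is the determinant of the metric -/
def sqrtNegDet (x : Coord) : ℝ := Real.sqrt (-(g.comp x).det)

/-- Christoffel symbols `Γ^γ_{μν}` of the Levi-Civita connection -/
def christoffel (γ μ ν : Fin 4) (x : Coord) : ℝ :=
  ∑ l, (1 / 2) * g.up γ l x * (pd μ (g.lo l ν) x + pd ν (g.lo l μ) x - pd l (g.lo μ ν) x)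

/-- Riemann tensor `R^γ_{λμν}`, with `[∇_μ, ∇_ν] A^γ = R^γ_{λμν} A^λ` -/
def riemann (γ l μ ν : Fin 4) (x : Coord) : ℝ :=
  pd μ (g.christoffel γ ν l) x - pd ν (g.christoffel γ μ l) x
    + ∑ a, (g.christoffel γ μ a x * g.christoffel a ν l x
        - g.christoffel γ ν a x * g.christoffel a μ l x)

/-- Ricci tensor `R_{μν} = R^a_{μaν}` -/
def ricci (μ ν : Fin 4) (x : Coord) : ℝ := ∑ a, g.riemann a μ a ν x

/-- scalar curvature `R = g^{μν} R_{μν}` -/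
def scalarCurv (x : Coord) : ℝ := ∑ μ, ∑ ν, g.up μ ν x * g.ricci μ ν x

/-- Einstein tensor `G_{μν} = R_{μν} - ½ g_{μν} R` -/
def einstein (μ ν : Fin 4) (x : Coord) : ℝ :=
  g.ricci μ ν x - (1 / 2) * g.lo μ ν x * g.scalarCurv x

/-- d'Alembert operator `□F = (1/√(-g)) ∂_σ (√(-g) g^{σλ} ∂_λ F)` -/
def box (F : Coord → ℝ) (x : Coord) : ℝ :=
  (g.sqrtNegDet x)⁻¹ *
    ∑ σ, pd σ (fun y => g.sqrtNegDet y * ∑ l, g.up σ l y * pd l F y) x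

/-- second covariant derivative of a function, `∇_μ ∇_ν F = ∂_μ ∂_ν F - Γ^λ_{μν} ∂_λ F` -/
def hess (μ ν : Fin 4) (F : Coord → ℝ) (x : Coord) : ℝ :=
  pd μ (pd ν F) x - ∑ l, g.christoffel l μ ν x * pd l F x

/-- covariant derivative `∇_α S_{μν}` of a twice covariant tensor field -/
def covDerivLower (S : Fin 4 → Fin 4 → Coord → ℝ) (α μ ν : Fin 4) (x : Coord) : ℝ :=
  pd α (S μ ν) x - ∑ β, g.christoffel β α μ x * S β ν x - ∑ β, g.christoffel β α ν x * S μ β x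

/-- covariant divergence `∇^μ S_{μν} = g^{μα} ∇_α S_{μν}` -/
def divLower (S : Fin 4 → Fin 4 → Coord → ℝ) (ν : Fin 4) (x : Coord) : ℝ :=
  ∑ μ, ∑ α, g.up μ α x * g.covDerivLower S α μ ν x

/-- raising both indices, `S^{μν} = g^{μα} g^{νβ} S_{αβ}` -/
def raise (S : Fin 4 → Fin 4 → Coord → ℝ) (μ ν : Fin 4) (x : Coord) : ℝ :=
  ∑ α, ∑ β, g.up μ α x * g.up ν β x * S α β x

/-- covariant derivative `∇_α A^{μν}` of a twice contravariant tensor field -/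
def covDerivUpper (A : Fin 4 → Fin 4 → Coord → ℝ) (α μ ν : Fin 4) (x : Coord) : ℝ :=
  pd α (A μ ν) x + ∑ β, g.christoffel μ α β x * A β ν x + ∑ β, g.christoffel ν α β x * A μ β x

/-- covariant divergence `∇_μ A^{μν}` -/
def divUpper (A : Fin 4 → Fin 4 → Coord → ℝ) (ν : Fin 4) (x : Coord) : ℝ :=
  ∑ μ, g.covDerivUpper A μ μ ν x

/-! ### `√(-g) □` maps test functions to test functions -/

theorem det_neg {x : Coord} (hx : x ∈ Ω) : (g.comp x).det < 0 := by
  obtain ⟨P, hP, h⟩ := g.lorentzian x hx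
  have hP0 : P.det ≠ 0 := hP.ne_zero
  have key : P.det ^ 2 * (g.comp x).det = -1 := by
    rcases h with h | h <;>
    · have h2 := congrArg Matrix.det h
      rw [Matrix.det_mul, Matrix.det_mul, Matrix.det_transpose, Matrix.det_diagonal] at h2
      simp [Fin.prod_univ_four] at h2
      linarith
  have : 0 < P.det ^ 2 := by positivity
  by_contra hc
  push Not at hc
  nlinarith [mul_nonneg this.le hc]

theorem contDiffOn_det : ContDiffOn ℝ ∞ (fun x => (g.comp x).det) Ω := by
  simp only [Matrix.det_apply]
  refine ContDiffOn.sum fun s _ => ?_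
  refine ContDiffOn.const_smul _ ?_
  exact contDiffOn_prod fun i _ => g.smooth _ _

theorem contDiffOn_sqrtNegDet : ContDiffOn ℝ ∞ g.sqrtNegDet Ω :=
  g.contDiffOn_det.neg.sqrt fun x hx => by
    have := g.det_neg hx
    linarith

theorem contDiffOn_up (μ ν : Fin 4) : ContDiffOn ℝ ∞ (g.up μ ν) Ω := by
  have h1 : ContDiffOn ℝ ∞ (fun x => (g.comp x).adjugate μ ν) Ω := by
    simp only [Matrix.adjugate_apply, Matrix.det_apply]
    refine ContDiffOn.sum fun s _ => ?_
    refine ContDiffOn.const_smul _ ?_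
    refine contDiffOn_prod fun i _ => ?_
    by_cases h : s i = ν
    · simpa [Matrix.updateRow_apply, h] using contDiffOn_const
    · simpa [Matrix.updateRow_apply, h] using g.smooth _ _
  have h2 : ContDiffOn ℝ ∞ (fun x => ((g.comp x).det)⁻¹ * (g.comp x).adjugate μ ν) Ω :=
    (g.contDiffOn_det.inv fun x hx => (g.det_neg hx).ne).mul h1
  refine h2.congr fun x _ => ?_
  simp [up, Matrix.inv_def]

theorem contDiffOn_pd (μ : Fin 4) {F : Coord → ℝ} (hF : ContDiffOn ℝ ∞ F Ω) :
    ContDiffOn ℝ ∞ (pd μ F) Ω :=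
  (hF.fderiv_of_isOpen Ω.isOpen (by simp)).clm_apply contDiffOn_const

theorem contDiffOn_box {F : Coord → ℝ} (hF : ContDiffOn ℝ ∞ F Ω) :
    ContDiffOn ℝ ∞ (g.box F) Ω := by
  refine (g.contDiffOn_sqrtNegDet.inv fun x hx => ?_).mul (ContDiffOn.sum fun σ _ => ?_)
  · have := g.det_neg hx
    exact (Real.sqrt_pos.2 (by linarith)).ne'
  · exact contDiffOn_pd σ (g.contDiffOn_sqrtNegDet.mul
      (ContDiffOn.sum fun l _ => (g.contDiffOn_up σ l).mul (contDiffOn_pd l hF)))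

theorem pd_eq_zero {μ : Fin 4} {F : Coord → ℝ} {x : Coord} (h : F =ᶠ[𝓝 x] 0) :
    pd μ F x = 0 := by
  simp [pd, h.fderiv_eq]

theorem box_eq_zero {F : Coord → ℝ} {x : Coord} (h : F =ᶠ[𝓝 x] 0) : g.box F x = 0 := by
  have h2 : ∀ σ, pd σ (fun y => g.sqrtNegDet y * ∑ l, g.up σ l y * pd l F y) x = 0 := by
    intro σ
    refine pd_eq_zero ?_
    filter_upwards [h.eventuallyEq_nhds] with y hy
    simp [pd_eq_zero hy]
  simp [box, h2]

theorem tsupport_box_subset (h : 𝓓(Ω, ℝ)) :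
    tsupport (fun x => g.sqrtNegDet x * g.box h x) ⊆ tsupport h := by
  refine closure_minimal (fun x hx => ?_) (isClosed_tsupport _)
  by_contra hc
  exact hx (by simp [g.box_eq_zero (notMem_tsupport_iff_eventuallyEq.1 hc)])

/-- The test function `√(-g) □h`.  The operator `√(-g) □ = ∂_σ √(-g) g^{σλ} ∂_λ` is its own formal
transpose with respect to `d⁴x`, so `⟨√(-g) □G, h⟩ = ⟨G, √(-g) □h⟩` for a distribution `G`. -/
def boxTest (h : 𝓓(Ω, ℝ)) : 𝓓(Ω, ℝ) where
  toFun x := g.sqrtNegDet x * g.box h x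
  contDiff' := by
    refine contDiff_iff_contDiffAt.2 fun x => ?_
    by_cases hx : x ∈ tsupport h
    · have hΩ : (Ω : Set Coord) ∈ 𝓝 x := Ω.isOpen.mem_nhds (h.tsupport_subset hx)
      exact (g.contDiffOn_sqrtNegDet.mul (g.contDiffOn_box h.contDiff.contDiffOn)).contDiffAt hΩ
    · have h0 := notMem_tsupport_iff_eventuallyEq.1 hx
      refine (contDiffAt_const (c := (0 : ℝ))).congr_of_eventuallyEq ?_
      filter_upwards [h0.eventuallyEq_nhds] with y hy
      simp [g.box_eq_zero hy]
  hasCompactSupport' :=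
    h.hasCompactSupport.of_isClosed_subset (isClosed_tsupport _) (g.tsupport_box_subset h)
  tsupport_subset' := (g.tsupport_box_subset h).trans h.tsupport_subset

/-- `G` is a retarded Green function of `□` on `Ω`: for every source point `x'`, the distribution
`G x' = G(·, x')` satisfies `√(-g(x)) □_x G(x, x') = δ⁴(x - x')` and vanishes where `t < t'`.
Distributions are paired with test functions through `d⁴x`. -/
structure IsRetardedGreen (G : Coord → 𝓓'(Ω, ℝ)) : Prop where
  green : ∀ x' ∈ Ω, ∀ h : 𝓓(Ω, ℝ), G x' (g.boxTest h) = (Distribution.delta x' : 𝓓'(Ω, ℝ)) h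
  retarded : ∀ x' ∈ Ω, ∀ h : 𝓓(Ω, ℝ), (∀ x ∈ tsupport h, x 0 < x' 0) → G x' h = 0

/-- `u = □⁻¹ p` on `Ω`: `u` is smooth and
`u(x) = ∫_Ω d⁴x' √(-g(x')) G(x, x') p(x')`, where, `G(·, x')` being a distribution, the integral is
understood weakly, that is, after pairing both sides with an arbitrary test function `h(x) d⁴x`. -/
structure IsBoxInv (G : Coord → 𝓓'(Ω, ℝ)) (p u : Coord → ℝ) : Prop where
  smooth : ContDiffOn ℝ ∞ u Ω
  integrable : ∀ h : 𝓓(Ω, ℝ),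
    IntegrableOn (fun x' => g.sqrtNegDet x' * G x' h * p x') Ω
  eq_integral : ∀ h : 𝓓(Ω, ℝ),
    ∫ x in Ω, u x * h x = ∫ x' in Ω, g.sqrtNegDet x' * G x' h * p x'

/-- The non-local correction, as a function of `f`, `U = □⁻¹R` and `V = □⁻¹[R f'(□⁻¹R)]`:
`ΔG_{μν} = (G_{μν} + g_{μν} □ - ∇_μ ∇_ν) [f(U) + V]
  + [δ_μ^{(σ} δ_ν^{λ)} - ½ g_{μν} g^{σλ}] ∂_σ V ∂_λ U`. -/
def deltaG (f : ℝ → ℝ) (U V : Coord → ℝ) (μ ν : Fin 4) (x : Coord) : ℝ :=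
  g.einstein μ ν x * (f (U x) + V x)
    + g.lo μ ν x * g.box (fun y => f (U y) + V y) x
    - g.hess μ ν (fun y => f (U y) + V y) x
    + ∑ σ, ∑ l,
        ((1 / 2) * ((if σ = μ then 1 else 0) * (if l = ν then 1 else 0)
            + (if l = μ then 1 else 0) * (if σ = ν then 1 else 0))
          - (1 / 2) * g.lo μ ν x * g.up σ l x) * pd σ V x * pd l U x

end LorentzMetric

end

end NonlocalGravity

/-!
The divergence of `G_{μν}` vanishes by the contracted second Bianchi identity, and commuting
covariant derivatives gives `∇^μ (G_{μν} + g_{μν} □ - ∇_μ ∇_ν) F = -½ R ∂_ν F` for every `F`. With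
`U = □⁻¹R` and `V = □⁻¹[R f'(U)]` the bilinear term has divergence `½ (□V ∂_ν U + □U ∂_ν V)`.
Green's identity turns the weak definition of `□⁻¹` into the pointwise equations `□U = R` and
`□V = R f'(U)`, so this is `½ R ∂_ν (f(U) + V)`, which cancels the first term at `F = f(U) + V`.

A tensor field is a matrix-valued function, each of its two indices being differentiated with a
connection of its own: the Leibniz rule, the Ricci identity, and the differential Bianchi identity
then become identities between matrices of functions.
-/

namespace NonlocalGravity

noncomputable section

variable {Ω : Opens Coord} {x : Coord}

/-! ### Partial derivatives -/

section PartialDerivative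

variable {F H : Coord → ℝ}

theorem differentiableAt_of_smooth (hF : ContDiffOn ℝ ∞ F Ω) (hx : x ∈ Ω) :
    DifferentiableAt ℝ F x :=
  (hF.contDiffAt (Ω.isOpen.mem_nhds hx)).differentiableAt (by simp)

theorem pd_congr (h : ∀ y ∈ Ω, F y = H y) (hx : x ∈ Ω) (μ : Fin 4) : pd μ F x = pd μ H x := by
  have : F =ᶠ[𝓝 x] H := Filter.eventuallyEq_of_mem (Ω.isOpen.mem_nhds hx) h
  simp only [pd, this.fderiv_eq]

theorem pd_const (μ : Fin 4) (c : ℝ) (x : Coord) : pd μ (fun _ ↦ c) x = 0 := by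
  simp [pd]

theorem pd_neg (μ : Fin 4) (F : Coord → ℝ) (x : Coord) :
    pd μ (fun y ↦ -F y) x = -pd μ F x := by
  simp [pd, fderiv_fun_neg]

theorem pd_add (hF : DifferentiableAt ℝ F x) (hH : DifferentiableAt ℝ H x) (μ : Fin 4) :
    pd μ (fun y ↦ F y + H y) x = pd μ F x + pd μ H x := by
  simp [pd, fderiv_fun_add hF hH]

theorem pd_sub (hF : DifferentiableAt ℝ F x) (hH : DifferentiableAt ℝ H x) (μ : Fin 4) :
    pd μ (fun y ↦ F y - H y) x = pd μ F x - pd μ H x := by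
  simp [pd, fderiv_fun_sub hF hH]

theorem pd_mul (hF : DifferentiableAt ℝ F x) (hH : DifferentiableAt ℝ H x) (μ : Fin 4) :
    pd μ (fun y ↦ F y * H y) x = pd μ F x * H x + F x * pd μ H x := by
  simp only [pd, fderiv_fun_mul hF hH, add_apply, smul_apply, smul_eq_mul]
  ring

theorem pd_sum {ι : Type*} {s : Finset ι} {F : ι → Coord → ℝ}
    (hF : ∀ i ∈ s, DifferentiableAt ℝ (F i) x) (μ : Fin 4) :
    pd μ (fun y ↦ ∑ i ∈ s, F i y) x = ∑ i ∈ s, pd μ (F i) x := by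
  simp [pd, fderiv_fun_sum hF]

theorem pd_comp {f : ℝ → ℝ} (hf : DifferentiableAt ℝ f (F x)) (hF : DifferentiableAt ℝ F x)
    (μ : Fin 4) : pd μ (fun y ↦ f (F y)) x = deriv f (F x) * pd μ F x := by
  have := (hf.hasDerivAt.comp_hasFDerivAt x hF.hasFDerivAt).fderiv
  simp [pd, ← Function.comp_def, this]

theorem pd_comm (hF : ContDiffOn ℝ ∞ F Ω) (hx : x ∈ Ω) (μ ν : Fin 4) :
    pd μ (pd ν F) x = pd ν (pd μ F) x := by
  have hFx : ContDiffAt ℝ 2 F x :=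
    (hF.contDiffAt (Ω.isOpen.mem_nhds hx)).of_le
      (by simpa using WithTop.coe_le_coe.2 (le_top (a := (2 : ℕ∞))))
  have hd : DifferentiableAt ℝ (fderiv ℝ F) x :=
    (hFx.fderiv_right (m := 1) (by norm_num)).differentiableAt (by simp)
  have pd_pd (a b : Fin 4) :
      pd a (pd b F) x = fderiv ℝ (fderiv ℝ F) x (Pi.single a 1) (Pi.single b 1) := by
    change fderiv ℝ (fun y ↦ fderiv ℝ F y (Pi.single b 1)) x (Pi.single a 1) = _
    simp [fderiv_clm_apply hd (differentiableAt_const _)]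
  rw [pd_pd, pd_pd, (hFx.isSymmSndFDerivAt (by simp)).eq]

end PartialDerivative

/-! ### Connections on trivial bundles -/

/-- Smoothness on `Ω` of all entries of a matrix-valued function. -/
def SmoothMat {m n : Type*} (Ω : Opens Coord) (M : Coord → Matrix m n ℝ) : Prop :=
  ∀ i j, ContDiffOn ℝ ∞ (fun y ↦ M y i j) Ω

/-- The entrywise partial derivative `∂_μ M` of a matrix-valued function. -/
def pdMat {m n : Type*} (μ : Fin 4) (M : Coord → Matrix m n ℝ) (x : Coord) : Matrix m n ℝ :=
  Matrix.of fun i j ↦ pd μ (fun y ↦ M y i j) x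

namespace SmoothMat

variable {l m n : Type*} {M N : Coord → Matrix m n ℝ}

theorem differentiableAt (hM : SmoothMat Ω M) (hx : x ∈ Ω) (i : m) (j : n) :
    DifferentiableAt ℝ (fun y ↦ M y i j) x :=
  differentiableAt_of_smooth (hM i j) hx

theorem add (hM : SmoothMat Ω M) (hN : SmoothMat Ω N) : SmoothMat Ω fun y ↦ M y + N y :=
  fun i j ↦ (hM i j).add (hN i j)

theorem sub (hM : SmoothMat Ω M) (hN : SmoothMat Ω N) : SmoothMat Ω fun y ↦ M y - N y :=
  fun i j ↦ (hM i j).sub (hN i j)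

theorem mul [Fintype m] {L : Coord → Matrix l m ℝ} (hL : SmoothMat Ω L) (hM : SmoothMat Ω M) :
    SmoothMat Ω fun y ↦ L y * M y := fun i j ↦ by
  simp only [Matrix.mul_apply]
  exact ContDiffOn.sum fun k _ ↦ (hL i k).mul (hM k j)

theorem pdMat (hM : SmoothMat Ω M) (μ : Fin 4) : SmoothMat Ω (pdMat μ M) :=
  fun i j ↦ LorentzMetric.contDiffOn_pd μ (hM i j)

end SmoothMat

section PdMat

variable {l m n : Type*} {M N : Coord → Matrix m n ℝ}

theorem pdMat_congr (h : ∀ y ∈ Ω, M y = N y) (hx : x ∈ Ω) (μ : Fin 4) :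
    pdMat μ M x = pdMat μ N x :=
  Matrix.ext fun _ _ ↦ pd_congr (fun y hy ↦ by rw [h y hy]) hx μ

theorem pdMat_const (C : Matrix m n ℝ) (μ : Fin 4) : pdMat μ (fun _ ↦ C) x = 0 :=
  Matrix.ext fun _ _ ↦ pd_const _ _ _

theorem pdMat_add (hM : SmoothMat Ω M) (hN : SmoothMat Ω N) (hx : x ∈ Ω) (μ : Fin 4) :
    pdMat μ (fun y ↦ M y + N y) x = pdMat μ M x + pdMat μ N x :=
  Matrix.ext fun i j ↦ pd_add (hM.differentiableAt hx i j) (hN.differentiableAt hx i j) μ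

theorem pdMat_sub (hM : SmoothMat Ω M) (hN : SmoothMat Ω N) (hx : x ∈ Ω) (μ : Fin 4) :
    pdMat μ (fun y ↦ M y - N y) x = pdMat μ M x - pdMat μ N x :=
  Matrix.ext fun i j ↦ pd_sub (hM.differentiableAt hx i j) (hN.differentiableAt hx i j) μ

theorem pdMat_neg (M : Coord → Matrix m n ℝ) (μ : Fin 4) (x : Coord) :
    pdMat μ (fun y ↦ -M y) x = -pdMat μ M x :=
  Matrix.ext fun _ _ ↦ pd_neg _ _ _

theorem pdMat_mul [Fintype m] {L : Coord → Matrix l m ℝ} (hL : SmoothMat Ω L)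
    (hM : SmoothMat Ω M) (hx : x ∈ Ω) (μ : Fin 4) :
    pdMat μ (fun y ↦ L y * M y) x = pdMat μ L x * M x + L x * pdMat μ M x := by
  ext i j
  simp only [pdMat, Matrix.of_apply, Matrix.add_apply, Matrix.mul_apply]
  rw [pd_sum fun k _ ↦ (hL.differentiableAt hx i k).fun_mul (hM.differentiableAt hx k j),
    ← Finset.sum_add_distrib]
  exact Finset.sum_congr rfl fun k _ ↦
    pd_mul (hL.differentiableAt hx i k) (hM.differentiableAt hx k j) μ

theorem pdMat_comm (hM : SmoothMat Ω M) (hx : x ∈ Ω) (μ ν : Fin 4) :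
    pdMat μ (pdMat ν M) x = pdMat ν (pdMat μ M) x :=
  Matrix.ext fun i j ↦ pd_comm (hM i j) hx μ ν

theorem pd_trace [Fintype m] {M : Coord → Matrix m m ℝ} (hM : SmoothMat Ω M) (hx : x ∈ Ω)
    (μ : Fin 4) : pd μ (fun y ↦ (M y).trace) x = (pdMat μ M x).trace :=
  pd_sum (fun i _ ↦ hM.differentiableAt hx i i) μ

theorem pd_det [Fintype m] [DecidableEq m] {M : Coord → Matrix m m ℝ}
    (hM : SmoothMat Ω M) (hx : x ∈ Ω) (μ : Fin 4) :
    pd μ (fun y ↦ (M y).det) x = ((M x).adjugate * pdMat μ M x).trace := by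
  let det : ContinuousMultilinearMap ℝ (fun _ : m ↦ m → ℝ) ℝ :=
    ⟨Matrix.detRowAlternating.toMultilinearMap, Continuous.matrix_det continuous_id⟩
  have hrow (i : m) : HasFDerivAt (fun y ↦ M y i)
      (ContinuousLinearMap.pi fun j ↦ fderiv ℝ (fun y ↦ M y i j) x) x :=
    hasFDerivAt_pi.2 fun j ↦ (hM.differentiableAt hx i j).hasFDerivAt
  have hdet := (HasFDerivAt.multilinear_comp (f := det) hrow).fderiv
  have hrows : pd μ (fun y ↦ (M y).det) x =
      ∑ i, ((M x).updateRow i (pdMat μ M x i)).det := by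
    rw [pd]
    refine (congrArg (· (Pi.single μ 1)) hdet).trans ?_
    simp only [sum_apply, ContinuousLinearMap.comp_apply]
    rfl
  rw [hrows, Matrix.trace_mul_comm]
  refine Finset.sum_congr rfl fun i _ ↦ ?_
  rw [← Matrix.cramer_transpose_apply, Matrix.cramer_eq_adjugate_mulVec,
    ← Matrix.adjugate_transpose, Matrix.mulVec_transpose]
  rfl

end PdMat

/-- A connection `∂_μ + A_μ` on the trivial bundle with fibre `m → ℝ`, given by its connection
matrices `A_μ`. The trivial connection is `0`. -/
abbrev Connection (m : Type*) : Type _ := Fin 4 → Coord → Matrix m m ℝ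

namespace Connection

variable {l m n : Type*} [Fintype l] [Fintype m] [Fintype n]
  {A : Connection l} {B : Connection m} {C : Connection n}

/-- The connection induced on the dual bundle. -/
def dual {m : Type*} (A : Connection m) : Connection m := fun μ y ↦ -(A μ y).transpose

/-- The covariant derivative of a matrix-valued function, that is, of a section of the bundle of
linear maps from the bundle of `B` to the bundle of `A`. A tensor with two upper indices is viewed
as a map out of the dual bundle, a tensor with two lower indices as a map into it. -/
def homDeriv (A : Connection l) (B : Connection m) (μ : Fin 4) (M : Coord → Matrix l m ℝ)
    (x : Coord) : Matrix l m ℝ :=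
  pdMat μ M x + A μ x * M x - M x * B μ x

/-- The curvature `F_{μν} = ∂_μ A_ν - ∂_ν A_μ + [A_μ, A_ν]`. -/
def curvature (A : Connection m) (μ ν : Fin 4) (x : Coord) : Matrix m m ℝ :=
  pdMat μ (A ν) x - pdMat ν (A μ) x + (A μ x * A ν x - A ν x * A μ x)

theorem smoothMat_dual {m : Type*} {A : Connection m} (hA : ∀ μ, SmoothMat Ω (A μ)) (μ : Fin 4) :
    SmoothMat Ω (A.dual μ) :=
  fun i j ↦ (hA μ j i).neg

theorem smoothMat_curvature (hA : ∀ μ, SmoothMat Ω (A μ)) (μ ν : Fin 4) :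
    SmoothMat Ω (A.curvature μ ν) :=
  (((hA ν).pdMat μ).sub ((hA μ).pdMat ν)).add
    (((hA μ).mul (hA ν)).sub ((hA ν).mul (hA μ)))

theorem homDeriv_congr {M N : Coord → Matrix l m ℝ} (h : ∀ y ∈ Ω, M y = N y) (hx : x ∈ Ω)
    (μ : Fin 4) : homDeriv A B μ M x = homDeriv A B μ N x := by
  rw [homDeriv, homDeriv, pdMat_congr h hx, h x hx]

theorem homDeriv_mul {M : Coord → Matrix l m ℝ} {N : Coord → Matrix m n ℝ} (hM : SmoothMat Ω M)
    (hN : SmoothMat Ω N) (hx : x ∈ Ω) (μ : Fin 4) :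
    homDeriv A C μ (fun y ↦ M y * N y) x =
      homDeriv A B μ M x * N x + M x * homDeriv B C μ N x := by
  simp only [homDeriv, pdMat_mul hM hN hx, Matrix.sub_mul, Matrix.add_mul, Matrix.mul_sub,
    Matrix.mul_add, Matrix.mul_assoc]
  abel

theorem homDeriv_one [DecidableEq l] (μ : Fin 4) : homDeriv A A μ (fun _ ↦ 1) x = 0 := by
  simp [homDeriv, pdMat_const]

theorem homDeriv_zero (μ : Fin 4) : homDeriv A B μ (fun _ ↦ 0) x = 0 := by
  simp [homDeriv, pdMat_const]

theorem homDeriv_neg (M : Coord → Matrix l m ℝ) (μ : Fin 4) (x : Coord) :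
    homDeriv A B μ (fun y ↦ -M y) x = -homDeriv A B μ M x := by
  rw [homDeriv, homDeriv, pdMat_neg, Matrix.mul_neg, Matrix.neg_mul]
  abel

theorem pd_trace_eq_trace_homDeriv {M : Coord → Matrix l l ℝ} (hM : SmoothMat Ω M) (hx : x ∈ Ω)
    (μ : Fin 4) : pd μ (fun y ↦ (M y).trace) x = (homDeriv A A μ M x).trace := by
  rw [pd_trace hM hx, homDeriv, Matrix.trace_sub, Matrix.trace_add, Matrix.trace_mul_comm (A μ x)]
  ring

theorem homDeriv_dual_transpose (M : Coord → Matrix l l ℝ) (μ : Fin 4) (x : Coord) :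
    homDeriv A A.dual μ (fun y ↦ (M y).transpose) x = (homDeriv A A.dual μ M x).transpose := by
  have hpd : pdMat μ (fun y ↦ (M y).transpose) x = (pdMat μ M x).transpose := rfl
  simp only [homDeriv, dual, hpd, Matrix.transpose_sub, Matrix.transpose_add,
    Matrix.transpose_mul, Matrix.transpose_neg, Matrix.transpose_transpose, Matrix.mul_neg]
  abel

theorem homDeriv_eq_zero_of_mul_eq_one [DecidableEq l] {A B : Connection l}
    {M N : Coord → Matrix l l ℝ} (hM : SmoothMat Ω M)
    (hN : SmoothMat Ω N) (hNM : ∀ y ∈ Ω, N y * M y = 1) (hx : x ∈ Ω) {μ : Fin 4}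
    (h : homDeriv A B μ M x = 0) : homDeriv B A μ N x = 0 := by
  have hNM' : homDeriv B A μ N x * M x = 0 := by
    rw [← homDeriv_one (A := B) μ, ← homDeriv_congr hNM hx, homDeriv_mul (B := A) hN hM hx, h]
    simp
  rw [← mul_one (homDeriv B A μ N x), ← mul_eq_one_comm.1 (hNM x hx), ← mul_assoc, hNM',
    zero_mul]

theorem curvature_antisymm (A : Connection l) (μ ν : Fin 4) (x : Coord) :
    A.curvature ν μ x = -A.curvature μ ν x := by
  rw [curvature, curvature]
  abel

theorem curvature_dual (A : Connection l) (μ ν : Fin 4) (x : Coord) :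
    A.dual.curvature μ ν x = -(A.curvature μ ν x).transpose := by
  have hpd (μ ν : Fin 4) : pdMat μ (A.dual ν) x = -(pdMat μ (A ν) x).transpose :=
    pdMat_neg _ _ _
  simp only [curvature, hpd]
  simp only [dual, Matrix.transpose_add, Matrix.transpose_sub, Matrix.transpose_mul,
    Matrix.neg_mul, Matrix.mul_neg]
  abel

theorem curvature_zero (μ ν : Fin 4) (x : Coord) :
    (0 : Connection l).curvature μ ν x = 0 := by
  have hpd (μ : Fin 4) : pdMat μ (0 : Coord → Matrix l l ℝ) x = 0 := pdMat_const 0 μ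
  simp [curvature, hpd]

theorem homDeriv_homDeriv_sub (hA : ∀ μ, SmoothMat Ω (A μ)) (hB : ∀ μ, SmoothMat Ω (B μ))
    {M : Coord → Matrix l m ℝ} (hM : SmoothMat Ω M) (hx : x ∈ Ω) (μ ν : Fin 4) :
    homDeriv A B μ (homDeriv A B ν M) x - homDeriv A B ν (homDeriv A B μ M) x =
      A.curvature μ ν x * M x - M x * B.curvature μ ν x := by
  have hD (μ ν : Fin 4) : homDeriv A B μ (homDeriv A B ν M) x =
      pdMat μ (pdMat ν M) x + (pdMat μ (A ν) x * M x + A ν x * pdMat μ M x)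
        - (pdMat μ M x * B ν x + M x * pdMat μ (B ν) x)
        + A μ x * homDeriv A B ν M x - homDeriv A B ν M x * B μ x := by
    rw [← pdMat_mul (hA ν) hM hx, ← pdMat_mul hM (hB ν) hx,
      ← pdMat_add (hM.pdMat ν) ((hA ν).mul hM) hx,
      ← pdMat_sub ((hM.pdMat ν).add ((hA ν).mul hM)) (hM.mul (hB ν)) hx]
    rfl
  rw [hD, hD, pdMat_comm hM hx ν μ]
  simp only [homDeriv, curvature, Matrix.sub_mul, Matrix.add_mul, Matrix.mul_sub,
    Matrix.mul_add, Matrix.mul_assoc]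
  abel

theorem homDeriv_curvature_cyclic (hA : ∀ μ, SmoothMat Ω (A μ)) (hx : x ∈ Ω) (α μ ν : Fin 4) :
    homDeriv A A α (A.curvature μ ν) x + homDeriv A A μ (A.curvature ν α) x
      + homDeriv A A ν (A.curvature α μ) x = 0 := by
  have hpd (α μ ν : Fin 4) : pdMat α (A.curvature μ ν) x =
      pdMat α (pdMat μ (A ν)) x - pdMat α (pdMat ν (A μ)) x
        + ((pdMat α (A μ) x * A ν x + A μ x * pdMat α (A ν) x)
          - (pdMat α (A ν) x * A μ x + A ν x * pdMat α (A μ) x)) := by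
    rw [← pdMat_mul (hA μ) (hA ν) hx, ← pdMat_mul (hA ν) (hA μ) hx,
      ← pdMat_sub ((hA μ).mul (hA ν)) ((hA ν).mul (hA μ)) hx,
      ← pdMat_sub ((hA ν).pdMat μ) ((hA μ).pdMat ν) hx,
      ← pdMat_add (((hA ν).pdMat μ).sub ((hA μ).pdMat ν))
        (((hA μ).mul (hA ν)).sub ((hA ν).mul (hA μ))) hx]
    rfl
  simp only [homDeriv, hpd, curvature, pdMat_comm (hA ν) hx α μ, pdMat_comm (hA μ) hx α ν,
    pdMat_comm (hA α) hx μ ν]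
  noncomm_ring

end Connection

/-- The matrix-valued function with entries `S μ ν`. -/
def matField {m n : Type*} (S : m → n → Coord → ℝ) (x : Coord) : Matrix m n ℝ :=
  Matrix.of fun i j ↦ S i j x

theorem smoothMat_matField {m n : Type*} {S : m → n → Coord → ℝ}
    (hS : ∀ i j, ContDiffOn ℝ ∞ (S i j) Ω) : SmoothMat Ω (matField S) := hS

/-! ### The Levi-Civita connection -/

namespace LorentzMetric

variable (g : LorentzMetric Ω)

/-- The inverse metric `g^{μν}` as a matrix-valued function. -/
def inv (x : Coord) : Matrix (Fin 4) (Fin 4) ℝ := (g.comp x)⁻¹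

/-- The Levi-Civita connection on vector fields, `(Γ_μ)^γ_λ = Γ^γ_{μλ}`. -/
def conn : Connection (Fin 4) := fun μ y ↦ Matrix.of fun γ l ↦ g.christoffel γ μ l y

theorem comp_mul_inv (hx : x ∈ Ω) : g.comp x * g.inv x = 1 :=
  Matrix.mul_nonsing_inv _ (g.det_neg hx).ne.isUnit

theorem inv_mul_comp (hx : x ∈ Ω) : g.inv x * g.comp x = 1 :=
  mul_eq_one_comm.1 (g.comp_mul_inv hx)

theorem inv_transpose (hx : x ∈ Ω) : (g.inv x).transpose = g.inv x := by
  rw [inv, Matrix.transpose_nonsing_inv, g.symm x hx]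

theorem lo_symm (hx : x ∈ Ω) (μ ν : Fin 4) : g.lo μ ν x = g.lo ν μ x :=
  (g.symm x hx).apply ν μ

theorem up_symm (hx : x ∈ Ω) (μ ν : Fin 4) : g.up μ ν x = g.up ν μ x :=
  congrFun (congrFun (g.inv_transpose hx) ν) μ

theorem sum_up_mul_lo (hx : x ∈ Ω) (μ ν : Fin 4) :
    ∑ α, g.up μ α x * g.lo α ν x = if μ = ν then 1 else 0 := by
  rw [← Matrix.one_apply, ← g.inv_mul_comp hx]
  rfl

theorem sum_lo_mul_up (hx : x ∈ Ω) (μ ν : Fin 4) :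
    ∑ α, g.lo μ α x * g.up α ν x = if μ = ν then 1 else 0 := by
  rw [← Matrix.one_apply, ← g.comp_mul_inv hx]
  rfl

theorem pd_lo_symm (hx : x ∈ Ω) (l μ ν : Fin 4) : pd l (g.lo μ ν) x = pd l (g.lo ν μ) x :=
  pd_congr (fun _ hy ↦ g.lo_symm hy μ ν) hx l

theorem christoffel_symm (hx : x ∈ Ω) (γ μ ν : Fin 4) :
    g.christoffel γ μ ν x = g.christoffel γ ν μ x := by
  simp only [christoffel, g.pd_lo_symm hx _ μ ν, add_comm (pd μ _ x)]

theorem contDiffOn_christoffel (γ μ ν : Fin 4) : ContDiffOn ℝ ∞ (g.christoffel γ μ ν) Ω :=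
  ContDiffOn.sum fun l _ ↦ (contDiffOn_const.mul (g.contDiffOn_up γ l)).mul
    (((contDiffOn_pd μ (g.smooth l ν)).add (contDiffOn_pd ν (g.smooth l μ))).sub
      (contDiffOn_pd l (g.smooth μ ν)))

theorem smoothMat_inv : SmoothMat Ω g.inv := g.contDiffOn_up

theorem smoothMat_conn (μ : Fin 4) : SmoothMat Ω (g.conn μ) :=
  fun γ l ↦ g.contDiffOn_christoffel γ μ l

theorem sum_lo_mul_christoffel (hx : x ∈ Ω) (α μ β : Fin 4) :
    ∑ γ, g.lo α γ x * g.christoffel γ μ β x =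
      (1 / 2) * (pd μ (g.lo α β) x + pd β (g.lo α μ) x - pd α (g.lo μ β) x) := by
  set c : Fin 4 → ℝ := fun l ↦ (1 / 2) *
    (pd μ (g.lo l β) x + pd β (g.lo l μ) x - pd l (g.lo μ β) x)
  calc ∑ γ, g.lo α γ x * g.christoffel γ μ β x
      = ∑ l, (∑ γ, g.lo α γ x * g.up γ l x) * c l := by
        simp only [christoffel, c, Finset.mul_sum, Finset.sum_mul]
        rw [Finset.sum_comm]
        exact Finset.sum_congr rfl fun _ _ ↦ Finset.sum_congr rfl fun _ _ ↦ by ring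
    _ = c α := by simp [g.sum_lo_mul_up hx]

theorem covDerivLower_eq_homDeriv (S : Fin 4 → Fin 4 → Coord → ℝ) (α μ ν : Fin 4) (x : Coord) :
    g.covDerivLower S α μ ν x = g.conn.dual.homDeriv g.conn α (matField S) x μ ν := by
  simp [covDerivLower, Connection.homDeriv, Connection.dual, conn, pdMat, matField,
    Matrix.mul_apply, mul_comm, ← sub_eq_add_neg]

theorem covDerivUpper_eq_homDeriv (A : Fin 4 → Fin 4 → Coord → ℝ) (α μ ν : Fin 4) (x : Coord) :
    g.covDerivUpper A α μ ν x = g.conn.homDeriv g.conn.dual α (matField A) x μ ν := by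
  simp [covDerivUpper, Connection.homDeriv, Connection.dual, conn, pdMat, matField,
    Matrix.mul_apply, mul_comm]

theorem riemann_eq_curvature (γ l μ ν : Fin 4) (x : Coord) :
    g.riemann γ l μ ν x = g.conn.curvature μ ν x γ l := by
  simp [riemann, Connection.curvature, conn, pdMat, Matrix.mul_apply]

theorem covDerivLower_lo (hx : x ∈ Ω) (μ α β : Fin 4) : g.covDerivLower g.lo μ α β x = 0 := by
  have hα : ∑ γ, g.christoffel γ μ α x * g.lo γ β x =
      (1 / 2) * (pd μ (g.lo α β) x + pd α (g.lo μ β) x - pd β (g.lo μ α) x) := by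
    rw [g.pd_lo_symm hx μ α β, g.pd_lo_symm hx α μ β, ← g.sum_lo_mul_christoffel hx β μ α]
    exact Finset.sum_congr rfl fun γ _ ↦ by rw [g.lo_symm hx γ β, mul_comm]
  have hβ : ∑ γ, g.christoffel γ μ β x * g.lo α γ x =
      (1 / 2) * (pd μ (g.lo α β) x + pd β (g.lo μ α) x - pd α (g.lo μ β) x) := by
    rw [g.pd_lo_symm hx β μ α, ← g.sum_lo_mul_christoffel hx α μ β]
    exact Finset.sum_congr rfl fun γ _ ↦ mul_comm _ _
  rw [covDerivLower, hα, hβ]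
  ring

theorem homDeriv_comp (hx : x ∈ Ω) (μ : Fin 4) : g.conn.dual.homDeriv g.conn μ g.comp x = 0 :=
  Matrix.ext fun α β ↦
    (g.covDerivLower_eq_homDeriv g.lo μ α β x).symm.trans (g.covDerivLower_lo hx μ α β)

theorem homDeriv_inv (hx : x ∈ Ω) (μ : Fin 4) :
    g.conn.homDeriv g.conn.dual μ g.inv x = 0 :=
  Connection.homDeriv_eq_zero_of_mul_eq_one g.smooth g.smoothMat_inv (fun _ ↦ g.inv_mul_comp) hx
    (g.homDeriv_comp hx μ)

/-! ### The contracted Bianchi identity -/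

/-- The curvature with its second index raised, `(K_{μν})^{γλ} = R^{γλ}_{μν}`. -/
def curvUp (μ ν : Fin 4) (x : Coord) : Matrix (Fin 4) (Fin 4) ℝ :=
  g.conn.curvature μ ν x * g.inv x

/-- The Ricci tensor with its first index raised, `R^μ_ν`. -/
def ricciMixed (x : Coord) : Matrix (Fin 4) (Fin 4) ℝ := g.inv x * matField g.ricci x

/-- The covariant divergence `∇_α M^α_j` over the row index, the column index being differentiated
with the connection `B`. -/
def covDiv {n : Type*} [Fintype n] (B : Connection n) (M : Coord → Matrix (Fin 4) n ℝ)
    (x : Coord) (j : n) : ℝ :=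
  ∑ α, g.conn.homDeriv B α M x α j

theorem contDiffOn_ricci (μ ν : Fin 4) : ContDiffOn ℝ ∞ (g.ricci μ ν) Ω := by
  refine ContDiffOn.sum fun a _ ↦ ?_
  simp only [riemann_eq_curvature]
  exact Connection.smoothMat_curvature g.smoothMat_conn a ν a μ

theorem smoothMat_curvUp (μ ν : Fin 4) : SmoothMat Ω (g.curvUp μ ν) :=
  (Connection.smoothMat_curvature g.smoothMat_conn μ ν).mul g.smoothMat_inv

theorem smoothMat_ricciMixed : SmoothMat Ω g.ricciMixed :=
  g.smoothMat_inv.mul g.contDiffOn_ricci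

theorem curvUp_swap (μ ν : Fin 4) (x : Coord) : g.curvUp ν μ x = -g.curvUp μ ν x := by
  rw [curvUp, Connection.curvature_antisymm, Matrix.neg_mul, curvUp]

theorem curvUp_transpose (hx : x ∈ Ω) (μ ν : Fin 4) :
    (g.curvUp μ ν x).transpose = -g.curvUp μ ν x := by
  have hDD (α β : Fin 4) :
      g.conn.homDeriv g.conn.dual α (g.conn.homDeriv g.conn.dual β g.inv) x = 0 := by
    rw [Connection.homDeriv_congr (fun y hy ↦ g.homDeriv_inv hy β) hx, Connection.homDeriv_zero]
  have hF := Connection.homDeriv_homDeriv_sub g.smoothMat_conn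
    (Connection.smoothMat_dual g.smoothMat_conn) g.smoothMat_inv hx μ ν
  rw [hDD, hDD, sub_zero, Connection.curvature_dual, Matrix.mul_neg, sub_neg_eq_add] at hF
  rw [curvUp, Matrix.transpose_mul, g.inv_transpose hx]
  exact eq_neg_of_add_eq_zero_right hF.symm

theorem curvUp_apply_swap (hx : x ∈ Ω) (μ ν a b : Fin 4) :
    g.curvUp μ ν x b a = -g.curvUp μ ν x a b :=
  congrFun (congrFun (g.curvUp_transpose hx μ ν) a) b

theorem ricciMixed_apply (hx : x ∈ Ω) (a μ : Fin 4) :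
    g.ricciMixed x a μ = ∑ b, g.curvUp μ b x a b := by
  calc g.ricciMixed x a μ = ∑ c, g.up a c x * ∑ b, g.riemann b c b μ x := rfl
    _ = ∑ b, ∑ c, g.riemann b c b μ x * g.up c a x := by
        simp only [Finset.mul_sum, g.up_symm hx a]
        rw [Finset.sum_comm]
        simp only [mul_comm]
    _ = ∑ b, g.curvUp b μ x b a := by
        simp only [riemann_eq_curvature]
        rfl
    _ = ∑ b, g.curvUp μ b x a b := by
        simp only [g.curvUp_swap μ, Matrix.neg_apply, g.curvUp_apply_swap hx _ _ a, neg_neg]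

theorem trace_ricciMixed (hx : x ∈ Ω) : (g.ricciMixed x).trace = g.scalarCurv x := by
  calc (g.ricciMixed x).trace = ∑ ν, ∑ μ, g.up ν μ x * g.ricci μ ν x := rfl
    _ = ∑ ν, ∑ μ, g.up μ ν x * g.ricci μ ν x :=
        Finset.sum_congr rfl fun ν _ ↦ Finset.sum_congr rfl fun μ _ ↦ by rw [g.up_symm hx]
    _ = g.scalarCurv x := Finset.sum_comm

theorem homDeriv_curvUp_cyclic (hx : x ∈ Ω) (α μ ν : Fin 4) :
    g.conn.homDeriv g.conn.dual α (g.curvUp μ ν) x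
      + g.conn.homDeriv g.conn.dual μ (g.curvUp ν α) x
      + g.conn.homDeriv g.conn.dual ν (g.curvUp α μ) x = 0 := by
  have hD (α μ ν : Fin 4) : g.conn.homDeriv g.conn.dual α (g.curvUp μ ν) x =
      g.conn.homDeriv g.conn α (g.conn.curvature μ ν) x * g.inv x := by
    rw [← add_zero (_ * _), ← Matrix.mul_zero (g.conn.curvature μ ν x), ← g.homDeriv_inv hx α]
    exact Connection.homDeriv_mul (Connection.smoothMat_curvature g.smoothMat_conn μ ν)
      g.smoothMat_inv hx α
  rw [hD, hD, hD, ← Matrix.add_mul, ← Matrix.add_mul,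
    Connection.homDeriv_curvature_cyclic g.smoothMat_conn hx, Matrix.zero_mul]

theorem homDeriv_curvUp_swap_apply_swap (hx : x ∈ Ω) (α μ ν a b : Fin 4) :
    g.conn.homDeriv g.conn.dual α (g.curvUp ν μ) x b a =
      g.conn.homDeriv g.conn.dual α (g.curvUp μ ν) x a b := by
  have hT : ∀ y ∈ Ω, g.curvUp ν μ y = (g.curvUp μ ν y).transpose := fun y hy ↦ by
    rw [g.curvUp_swap, g.curvUp_transpose hy]
  rw [Connection.homDeriv_congr hT hx, Connection.homDeriv_dual_transpose, Matrix.transpose_apply]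

/-- The two connection terms appear because `∇_α R^{ab}_{μb}` is here the derivative of a family of
sections labelled by `μ` and `b`, not of a tensor. -/
theorem sum_homDeriv_curvUp (hx : x ∈ Ω) (α μ a : Fin 4) :
    ∑ b, g.conn.homDeriv g.conn.dual α (g.curvUp μ b) x a b =
      g.conn.homDeriv g.conn α g.ricciMixed x a μ
        + ∑ c, g.ricciMixed x a c * g.christoffel c α μ x
        + ∑ b, ∑ c, g.christoffel b α c x * g.curvUp μ b x a c := by
  have hpd : pd α (fun y ↦ g.ricciMixed y a μ) x = ∑ b, pd α (fun y ↦ g.curvUp μ b y a b) x := by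
    rw [pd_congr (fun y hy ↦ g.ricciMixed_apply hy a μ) hx,
      pd_sum fun b _ ↦ (g.smoothMat_curvUp μ b).differentiableAt hx a b]
  have hconn : ∑ b, ∑ c, g.christoffel a α c x * g.curvUp μ b x c b =
      ∑ c, g.christoffel a α c x * g.ricciMixed x c μ := by
    rw [Finset.sum_comm]
    simp only [g.ricciMixed_apply hx, Finset.mul_sum]
  simp [Connection.homDeriv, Connection.dual, pdMat, Matrix.mul_apply, conn, hpd,
    Finset.sum_add_distrib, hconn, mul_comm (g.curvUp _ _ _ _ _)]

theorem sum_ricciMixed_mul_christoffel_eq (hx : x ∈ Ω) (α : Fin 4) :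
    ∑ μ, ∑ ν, ∑ c, g.christoffel ν α c x * g.curvUp μ ν x μ c =
      ∑ μ, ∑ c, g.ricciMixed x μ c * g.christoffel c α μ x := by
  have hK (c ν : Fin 4) : ∑ μ, g.curvUp μ ν x μ c = g.ricciMixed x c ν := by
    rw [g.ricciMixed_apply hx]
    exact Finset.sum_congr rfl fun μ _ ↦ by
      rw [g.curvUp_swap ν μ, Matrix.neg_apply, g.curvUp_apply_swap hx, neg_neg]
  calc ∑ μ, ∑ ν, ∑ c, g.christoffel ν α c x * g.curvUp μ ν x μ c
      = ∑ ν, ∑ c, g.christoffel ν α c x * ∑ μ, g.curvUp μ ν x μ c := by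
        rw [Finset.sum_comm]
        refine Finset.sum_congr rfl fun ν _ ↦ ?_
        rw [Finset.sum_comm]
        simp only [Finset.mul_sum]
    _ = ∑ μ, ∑ c, g.ricciMixed x μ c * g.christoffel c α μ x := by
        rw [Finset.sum_comm]
        simp only [hK, mul_comm]

theorem sum_christoffel_mul_curvUp_eq_zero (hx : x ∈ Ω) (α ν : Fin 4) :
    ∑ μ, ∑ c, g.christoffel ν μ c x * g.curvUp α ν x μ c = 0 := by
  refine self_eq_neg.1 ?_
  calc ∑ μ, ∑ c, g.christoffel ν μ c x * g.curvUp α ν x μ c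
      = ∑ μ, ∑ c, g.christoffel ν c μ x * g.curvUp α ν x c μ := Finset.sum_comm
    _ = -∑ μ, ∑ c, g.christoffel ν μ c x * g.curvUp α ν x μ c := by
        simp only [← Finset.sum_neg_distrib]
        refine Finset.sum_congr rfl fun μ _ ↦ Finset.sum_congr rfl fun c _ ↦ ?_
        rw [g.christoffel_symm hx, g.curvUp_apply_swap hx, mul_neg]

theorem sum_homDeriv_curvUp_eq_pd_scalarCurv (hx : x ∈ Ω) (α : Fin 4) :
    ∑ μ, ∑ ν, g.conn.homDeriv g.conn.dual α (g.curvUp μ ν) x μ ν =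
      pd α g.scalarCurv x + 2 * ∑ μ, ∑ c, g.ricciMixed x μ c * g.christoffel c α μ x := by
  have htr : ∑ μ, g.conn.homDeriv g.conn α g.ricciMixed x μ μ = pd α g.scalarCurv x := by
    rw [← pd_congr (fun y hy ↦ g.trace_ricciMixed hy) hx,
      Connection.pd_trace_eq_trace_homDeriv (A := g.conn) g.smoothMat_ricciMixed hx]
    rfl
  simp only [g.sum_homDeriv_curvUp hx, Finset.sum_add_distrib, htr,
    g.sum_ricciMixed_mul_christoffel_eq hx]
  ring

theorem sum_homDeriv_curvUp_eq_covDiv_ricciMixed (hx : x ∈ Ω) (α : Fin 4) :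
    ∑ μ, ∑ ν, g.conn.homDeriv g.conn.dual μ (g.curvUp α ν) x μ ν =
      g.covDiv g.conn g.ricciMixed x α
        + ∑ μ, ∑ c, g.ricciMixed x μ c * g.christoffel c α μ x := by
  have hsymm : ∑ μ, ∑ ν, ∑ c, g.christoffel ν μ c x * g.curvUp α ν x μ c = 0 := by
    rw [Finset.sum_comm]
    simp only [g.sum_christoffel_mul_curvUp_eq_zero hx, Finset.sum_const_zero]
  simp only [g.sum_homDeriv_curvUp hx, Finset.sum_add_distrib, hsymm, add_zero, covDiv,
    g.christoffel_symm hx _ _ α]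

theorem covDiv_ricciMixed (hx : x ∈ Ω) (α : Fin 4) :
    g.covDiv g.conn g.ricciMixed x α = (1 / 2) * pd α g.scalarCurv x := by
  let D (α μ ν a b : Fin 4) : ℝ := g.conn.homDeriv g.conn.dual α (g.curvUp μ ν) x a b
  have hneg (μ ν : Fin 4) : D μ ν α μ ν = -D μ α ν μ ν := by
    simp only [D, show g.curvUp ν α = fun y ↦ -g.curvUp α ν y from
      funext (g.curvUp_swap α ν), Connection.homDeriv_neg, Matrix.neg_apply]
  have hbianchi : ∑ μ, ∑ ν, (D α μ ν μ ν + D μ ν α μ ν + D ν μ α ν μ) = 0 :=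
    Finset.sum_eq_zero fun μ _ ↦ Finset.sum_eq_zero fun ν _ ↦ by
      simp only [D, g.homDeriv_curvUp_swap_apply_swap hx ν α μ μ ν]
      exact congrFun (congrFun (g.homDeriv_curvUp_cyclic hx α μ ν) μ) ν
  have hcomm : ∑ μ, ∑ ν, D ν α μ ν μ = ∑ μ, ∑ ν, D μ α ν μ ν := Finset.sum_comm
  simp only [hneg, Finset.sum_add_distrib, Finset.sum_neg_distrib, hcomm] at hbianchi
  simp only [D, g.sum_homDeriv_curvUp_eq_pd_scalarCurv hx,
    g.sum_homDeriv_curvUp_eq_covDiv_ricciMixed hx] at hbianchi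
  linarith

/-! ### Covariant divergences -/

theorem covDiv_inv_mul {n : Type*} [Fintype n] {B : Connection n}
    {M : Coord → Matrix (Fin 4) n ℝ} (hM : SmoothMat Ω M) (hx : x ∈ Ω) (j : n) :
    g.covDiv B (fun y ↦ g.inv y * M y) x j =
      ∑ α, ∑ μ, g.up α μ x * g.conn.dual.homDeriv B α M x μ j := by
  simp only [covDiv, Connection.homDeriv_mul (B := g.conn.dual) g.smoothMat_inv hM hx,
    g.homDeriv_inv hx, Matrix.zero_mul, zero_add]
  rfl

theorem covDiv_mul_inv {M : Coord → Matrix (Fin 4) (Fin 4) ℝ} (hM : SmoothMat Ω M) (hx : x ∈ Ω)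
    (ν : Fin 4) : g.covDiv g.conn.dual (fun y ↦ M y * g.inv y) x ν =
      ∑ β, g.covDiv g.conn M x β * g.up β ν x := by
  simp only [covDiv, Connection.homDeriv_mul (B := g.conn) hM g.smoothMat_inv hx,
    g.homDeriv_inv hx, Matrix.mul_zero, add_zero, Matrix.mul_apply, Finset.sum_mul]
  exact Finset.sum_comm

theorem divLower_eq_covDiv {S : Fin 4 → Fin 4 → Coord → ℝ} (hS : ∀ μ ν, ContDiffOn ℝ ∞ (S μ ν) Ω)
    (hx : x ∈ Ω) (ν : Fin 4) :
    g.divLower S ν x = g.covDiv g.conn (fun y ↦ g.inv y * matField S y) x ν := by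
  rw [g.covDiv_inv_mul (smoothMat_matField hS) hx, divLower, Finset.sum_comm]
  simp only [covDerivLower_eq_homDeriv, g.up_symm hx]

theorem divUpper_raise {S : Fin 4 → Fin 4 → Coord → ℝ} (hS : ∀ μ ν, ContDiffOn ℝ ∞ (S μ ν) Ω)
    (hx : x ∈ Ω) (ν : Fin 4) :
    g.divUpper (g.raise S) ν x = ∑ β, g.divLower S β x * g.up β ν x := by
  have hraise : ∀ y ∈ Ω, matField (g.raise S) y = g.inv y * matField S y * g.inv y := by
    intro y hy
    ext μ ν
    simp only [matField, raise, Matrix.of_apply, Matrix.mul_apply, Finset.sum_mul]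
    rw [Finset.sum_comm]
    refine Finset.sum_congr rfl fun β _ ↦ Finset.sum_congr rfl fun α _ ↦ ?_
    rw [g.up_symm hy ν β]
    exact mul_right_comm _ _ _
  simp only [divUpper, covDerivUpper_eq_homDeriv, Connection.homDeriv_congr hraise hx,
    g.divLower_eq_covDiv hS hx]
  exact g.covDiv_mul_inv (g.smoothMat_inv.mul hS) hx ν

theorem sqrtNegDet_pos (hx : x ∈ Ω) : 0 < g.sqrtNegDet x :=
  Real.sqrt_pos.2 (by linarith [g.det_neg hx])

theorem pd_det_comp (hx : x ∈ Ω) (μ : Fin 4) :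
    pd μ (fun y ↦ (g.comp y).det) x = 2 * (g.comp x).det * (g.conn μ x).trace := by
  have hadj : (g.comp x).adjugate = (g.comp x).det • g.inv x := by
    rw [inv, Matrix.inv_def, smul_smul, Ring.mul_inverse_cancel _ (g.det_neg hx).ne.isUnit,
      one_smul]
  have hcomp : pdMat μ g.comp x = (g.conn μ x).transpose * g.comp x + g.comp x * g.conn μ x := by
    have h := g.homDeriv_comp hx μ
    rw [Connection.homDeriv, Connection.dual, Matrix.neg_mul] at h
    rw [← sub_eq_zero, ← h]
    abel
  rw [pd_det g.smooth hx, hadj, hcomp, Matrix.smul_mul, Matrix.trace_smul, Matrix.mul_add,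
    Matrix.trace_add, ← Matrix.mul_assoc _ (g.comp x), g.inv_mul_comp hx,
    Matrix.trace_mul_comm, Matrix.mul_assoc, g.comp_mul_inv hx]
  simp only [Matrix.one_mul, Matrix.mul_one, Matrix.trace_transpose, smul_eq_mul]
  ring

theorem pd_sqrtNegDet (hx : x ∈ Ω) (μ : Fin 4) :
    pd μ g.sqrtNegDet x = g.sqrtNegDet x * (g.conn μ x).trace := by
  have hs := differentiableAt_of_smooth g.contDiffOn_sqrtNegDet hx
  have hsq : ∀ y ∈ Ω, g.sqrtNegDet y * g.sqrtNegDet y = -(g.comp y).det := fun y hy ↦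
    Real.mul_self_sqrt (by linarith [g.det_neg hy])
  have hpd := pd_congr hsq hx μ
  rw [pd_mul hs hs, pd_neg, g.pd_det_comp hx] at hpd
  refine mul_left_cancel₀ (g.sqrtNegDet_pos hx).ne' ?_
  linear_combination hpd / 2 - (g.conn μ x).trace * hsq x hx

theorem sum_pd_sqrtNegDet_mul {W : Coord → Matrix (Fin 4) Unit ℝ} (hW : SmoothMat Ω W)
    (hx : x ∈ Ω) : ∑ σ, pd σ (fun y ↦ g.sqrtNegDet y * W y σ ()) x =
      g.sqrtNegDet x * g.covDiv 0 W x () := by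
  have hs := differentiableAt_of_smooth g.contDiffOn_sqrtNegDet hx
  have hconn : ∑ σ, (g.conn σ x * W x) σ () = ∑ σ, (g.conn σ x).trace * W x σ () := by
    simp only [Matrix.mul_apply, Matrix.trace, Finset.sum_mul]
    rw [Finset.sum_comm]
    refine Finset.sum_congr rfl fun σ _ ↦ Finset.sum_congr rfl fun β _ ↦ ?_
    congr 1
    exact g.christoffel_symm hx β β σ
  simp only [pd_mul hs (hW.differentiableAt hx _ _), g.pd_sqrtNegDet hx, covDiv,
    Connection.homDeriv, Matrix.sub_apply, Matrix.add_apply, Finset.sum_add_distrib,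
    Finset.sum_sub_distrib, hconn, mul_assoc, ← Finset.mul_sum, pdMat, Matrix.of_apply,
    Pi.zero_apply, Matrix.mul_zero, Matrix.zero_apply, Finset.sum_const_zero]
  ring

/-! ### The Hessian -/

variable {F H : Coord → ℝ}

/-- The differential `∂_ν F` as a column. -/
def differential (F : Coord → ℝ) (x : Coord) : Matrix (Fin 4) Unit ℝ :=
  Matrix.of fun ν _ ↦ pd ν F x

/-- The trace `g^{μα} S_{μα}`. -/
def tr (S : Fin 4 → Fin 4 → Coord → ℝ) (x : Coord) : ℝ := ∑ μ, ∑ α, g.up μ α x * S μ α x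

theorem smoothMat_differential (hF : ContDiffOn ℝ ∞ F Ω) : SmoothMat Ω (differential F) :=
  fun ν _ ↦ contDiffOn_pd ν hF

theorem smoothMat_gradient (hF : ContDiffOn ℝ ∞ F Ω) :
    SmoothMat Ω fun y ↦ g.inv y * differential F y :=
  g.smoothMat_inv.mul (smoothMat_differential hF)

theorem contDiffOn_hess (hF : ContDiffOn ℝ ∞ F Ω) (μ ν : Fin 4) :
    ContDiffOn ℝ ∞ (g.hess μ ν F) Ω :=
  (contDiffOn_pd μ (contDiffOn_pd ν hF)).sub
    (ContDiffOn.sum fun l _ ↦ (g.contDiffOn_christoffel l μ ν).mul (contDiffOn_pd l hF))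

theorem hess_symm (hF : ContDiffOn ℝ ∞ F Ω) (hx : x ∈ Ω) (μ ν : Fin 4) :
    g.hess μ ν F x = g.hess ν μ F x := by
  simp only [hess, pd_comm hF hx μ ν, g.christoffel_symm hx _ μ ν]

theorem homDeriv_dual_zero_apply (M : Coord → Matrix (Fin 4) Unit ℝ) (α ν : Fin 4) (x : Coord) :
    g.conn.dual.homDeriv 0 α M x ν () =
      pd α (fun y ↦ M y ν ()) x - ∑ l, g.christoffel l α ν x * M x l () := by
  simp [Connection.homDeriv, Connection.dual, conn, pdMat, Matrix.mul_apply, ← sub_eq_add_neg]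

theorem hess_eq_homDeriv (μ ν : Fin 4) (F : Coord → ℝ) (x : Coord) :
    g.hess μ ν F x = g.conn.dual.homDeriv 0 μ (differential F) x ν () :=
  (g.homDeriv_dual_zero_apply (differential F) μ ν x).symm

theorem box_eq_covDiv (hF : ContDiffOn ℝ ∞ F Ω) (hx : x ∈ Ω) :
    g.box F x = g.covDiv 0 (fun y ↦ g.inv y * differential F y) x () := by
  rw [← inv_mul_cancel_left₀ (g.sqrtNegDet_pos hx).ne' (g.covDiv 0 _ x ()),
    ← g.sum_pd_sqrtNegDet_mul (g.smoothMat_gradient hF) hx]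
  rfl

theorem box_eq_tr_hess (hF : ContDiffOn ℝ ∞ F Ω) (hx : x ∈ Ω) :
    g.box F x = g.tr (fun μ ν ↦ g.hess μ ν F) x := by
  simp only [g.box_eq_covDiv hF hx, g.covDiv_inv_mul (smoothMat_differential hF) hx, tr,
    hess_eq_homDeriv]

theorem tr_eq_trace (S : Fin 4 → Fin 4 → Coord → ℝ) (hx : x ∈ Ω) :
    g.tr S x = (g.inv x * matField S x).trace := by
  calc g.tr S x = ∑ α, ∑ μ, g.up μ α x * S μ α x := Finset.sum_comm
    _ = ∑ α, ∑ μ, g.up α μ x * S μ α x :=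
        Finset.sum_congr rfl fun α _ ↦ Finset.sum_congr rfl fun μ _ ↦ by rw [g.up_symm hx]
    _ = (g.inv x * matField S x).trace := rfl

theorem pd_tr {S : Fin 4 → Fin 4 → Coord → ℝ} (hS : ∀ μ ν, ContDiffOn ℝ ∞ (S μ ν) Ω) (hx : x ∈ Ω)
    (ν : Fin 4) : pd ν (g.tr S) x = g.tr (g.covDerivLower S ν) x := by
  have hcov : matField (g.covDerivLower S ν) x = g.conn.dual.homDeriv g.conn ν (matField S) x :=
    Matrix.ext fun α β ↦ g.covDerivLower_eq_homDeriv S ν α β x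
  rw [pd_congr (fun y hy ↦ g.tr_eq_trace S hy) hx,
    Connection.pd_trace_eq_trace_homDeriv (A := g.conn)
      (g.smoothMat_inv.mul (smoothMat_matField hS)) hx,
    Connection.homDeriv_mul (B := g.conn.dual) g.smoothMat_inv (smoothMat_matField hS) hx,
    g.homDeriv_inv hx, Matrix.zero_mul, zero_add, ← hcov, ← g.tr_eq_trace _ hx]

theorem covDerivLower_symm {S : Fin 4 → Fin 4 → Coord → ℝ}
    (hS : ∀ y ∈ Ω, ∀ μ ν, S μ ν y = S ν μ y) (hx : x ∈ Ω) (α μ ν : Fin 4) :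
    g.covDerivLower S α μ ν x = g.covDerivLower S α ν μ x := by
  simp only [covDerivLower, pd_congr (fun y hy ↦ hS y hy μ ν) hx, hS x hx μ, hS x hx _ ν]
  ring

theorem covDerivLower_hess_sub (hF : ContDiffOn ℝ ∞ F Ω) (hx : x ∈ Ω) (α β ν : Fin 4) :
    g.covDerivLower (fun μ ν ↦ g.hess μ ν F) α β ν x
      - g.covDerivLower (fun μ ν ↦ g.hess μ ν F) β α ν x =
      -∑ γ, g.riemann γ ν α β x * pd γ F x := by
  have hD (α β : Fin 4) : g.covDerivLower (fun μ ν ↦ g.hess μ ν F) α β ν x =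
      g.conn.dual.homDeriv 0 α (g.conn.dual.homDeriv 0 β (differential F)) x ν ()
        - ∑ γ, g.christoffel γ α β x * g.hess γ ν F x := by
    simp only [covDerivLower, homDeriv_dual_zero_apply g (g.conn.dual.homDeriv _ _ _),
      ← hess_eq_homDeriv]
    ring
  have hcomm := congrFun (congrFun (Connection.homDeriv_homDeriv_sub
    (Connection.smoothMat_dual g.smoothMat_conn) (B := 0) (fun _ _ _ ↦ contDiffOn_const)
    (smoothMat_differential hF) hx α β) ν) ()
  rw [Connection.curvature_zero, Matrix.mul_zero, sub_zero, Connection.curvature_dual,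
    Matrix.neg_mul] at hcomm
  simp only [hD, g.christoffel_symm hx _ β α, sub_sub_sub_cancel_right, riemann_eq_curvature]
  exact hcomm

theorem divLower_hess (hF : ContDiffOn ℝ ∞ F Ω) (hx : x ∈ Ω) (ν : Fin 4) :
    g.divLower (fun μ ν ↦ g.hess μ ν F) ν x =
      pd ν (g.box F) x + ∑ γ, g.ricciMixed x γ ν * pd γ F x := by
  have hcomm (μ α : Fin 4) : g.covDerivLower (fun μ ν ↦ g.hess μ ν F) α μ ν x =
      g.covDerivLower (fun μ ν ↦ g.hess μ ν F) ν μ α x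
        - ∑ γ, g.riemann γ μ α ν x * pd γ F x := by
    have hsymm : g.covDerivLower (fun μ ν ↦ g.hess μ ν F) α μ ν x =
        g.covDerivLower (fun μ ν ↦ g.hess μ ν F) α ν μ x :=
      g.covDerivLower_symm (fun y hy ↦ g.hess_symm hF hy) hx α μ ν
    have hsymm' : g.covDerivLower (fun μ ν ↦ g.hess μ ν F) ν μ α x =
        g.covDerivLower (fun μ ν ↦ g.hess μ ν F) ν α μ x :=
      g.covDerivLower_symm (fun y hy ↦ g.hess_symm hF hy) hx ν μ α
    rw [hsymm, hsymm']
    linear_combination g.covDerivLower_hess_sub hF hx α ν μ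
  have hricci (γ : Fin 4) :
      ∑ μ, ∑ α, g.up μ α x * g.riemann γ μ α ν x = -g.ricciMixed x γ ν := by
    rw [Finset.sum_comm, g.ricciMixed_apply hx, ← Finset.sum_neg_distrib]
    refine Finset.sum_congr rfl fun α _ ↦ ?_
    rw [g.curvUp_swap α ν, Matrix.neg_apply, neg_neg]
    simp only [riemann_eq_curvature, mul_comm (g.up _ _ _)]
    rfl
  calc g.divLower (fun μ ν ↦ g.hess μ ν F) ν x
      = g.tr (g.covDerivLower (fun μ ν ↦ g.hess μ ν F) ν) x
        - ∑ γ, (∑ μ, ∑ α, g.up μ α x * g.riemann γ μ α ν x) * pd γ F x := by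
        rw [divLower, Finset.sum_congr rfl fun μ _ ↦ Finset.sum_congr rfl fun α _ ↦ by
          rw [hcomm, mul_sub]]
        simp only [Finset.sum_sub_distrib, tr, Finset.sum_mul, Finset.mul_sum, mul_assoc]
        rw [Finset.sum_comm_cycle]
    _ = pd ν (g.box F) x + ∑ γ, g.ricciMixed x γ ν * pd γ F x := by
        rw [pd_congr (fun y hy ↦ g.box_eq_tr_hess hF hy) hx, g.pd_tr (g.contDiffOn_hess hF) hx]
        simp only [hricci, neg_mul, Finset.sum_neg_distrib, sub_neg_eq_add]

/-! ### Leibniz rules -/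

variable {φ : Coord → ℝ} {S S' : Fin 4 → Fin 4 → Coord → ℝ}

theorem covDerivLower_add (hS : ∀ μ ν, ContDiffOn ℝ ∞ (S μ ν) Ω)
    (hS' : ∀ μ ν, ContDiffOn ℝ ∞ (S' μ ν) Ω) (hx : x ∈ Ω) (α μ ν : Fin 4) :
    g.covDerivLower (fun μ ν y ↦ S μ ν y + S' μ ν y) α μ ν x =
      g.covDerivLower S α μ ν x + g.covDerivLower S' α μ ν x := by
  simp only [covDerivLower, pd_add (differentiableAt_of_smooth (hS μ ν) hx)
    (differentiableAt_of_smooth (hS' μ ν) hx), mul_add, Finset.sum_add_distrib]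
  ring

theorem covDerivLower_sub (hS : ∀ μ ν, ContDiffOn ℝ ∞ (S μ ν) Ω)
    (hS' : ∀ μ ν, ContDiffOn ℝ ∞ (S' μ ν) Ω) (hx : x ∈ Ω) (α μ ν : Fin 4) :
    g.covDerivLower (fun μ ν y ↦ S μ ν y - S' μ ν y) α μ ν x =
      g.covDerivLower S α μ ν x - g.covDerivLower S' α μ ν x := by
  simp only [covDerivLower, pd_sub (differentiableAt_of_smooth (hS μ ν) hx)
    (differentiableAt_of_smooth (hS' μ ν) hx), mul_sub, Finset.sum_sub_distrib]
  ring

theorem covDerivLower_mul (hS : ∀ μ ν, ContDiffOn ℝ ∞ (S μ ν) Ω) (hφ : DifferentiableAt ℝ φ x)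
    (hx : x ∈ Ω) (α μ ν : Fin 4) :
    g.covDerivLower (fun μ ν y ↦ S μ ν y * φ y) α μ ν x =
      g.covDerivLower S α μ ν x * φ x + S μ ν x * pd α φ x := by
  simp only [covDerivLower, pd_mul (differentiableAt_of_smooth (hS μ ν) hx) hφ, ← mul_assoc,
    ← Finset.sum_mul]
  ring

theorem covDerivLower_pd_mul_pd (hF : ContDiffOn ℝ ∞ F Ω) (hH : ContDiffOn ℝ ∞ H Ω) (hx : x ∈ Ω)
    (α μ ν : Fin 4) : g.covDerivLower (fun μ ν y ↦ pd μ F y * pd ν H y) α μ ν x =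
      g.hess α μ F x * pd ν H x + pd μ F x * g.hess α ν H x := by
  rw [covDerivLower, pd_mul (differentiableAt_of_smooth (contDiffOn_pd μ hF) hx)
    (differentiableAt_of_smooth (contDiffOn_pd ν hH) hx)]
  simp only [hess, ← mul_assoc, ← Finset.sum_mul, mul_right_comm _ (pd μ F x)]
  ring

theorem divLower_congr (h : ∀ y ∈ Ω, ∀ μ ν, S μ ν y = S' μ ν y) (hx : x ∈ Ω) (ν : Fin 4) :
    g.divLower S ν x = g.divLower S' ν x := by
  simp only [divLower, covDerivLower, pd_congr (fun y hy ↦ h y hy _ _) hx, h x hx]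

theorem divLower_add (hS : ∀ μ ν, ContDiffOn ℝ ∞ (S μ ν) Ω) (hS' : ∀ μ ν, ContDiffOn ℝ ∞ (S' μ ν) Ω)
    (hx : x ∈ Ω) (ν : Fin 4) : g.divLower (fun μ ν y ↦ S μ ν y + S' μ ν y) ν x =
      g.divLower S ν x + g.divLower S' ν x := by
  simp only [divLower, g.covDerivLower_add hS hS' hx, mul_add, Finset.sum_add_distrib]

theorem divLower_sub (hS : ∀ μ ν, ContDiffOn ℝ ∞ (S μ ν) Ω) (hS' : ∀ μ ν, ContDiffOn ℝ ∞ (S' μ ν) Ω)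
    (hx : x ∈ Ω) (ν : Fin 4) : g.divLower (fun μ ν y ↦ S μ ν y - S' μ ν y) ν x =
      g.divLower S ν x - g.divLower S' ν x := by
  simp only [divLower, g.covDerivLower_sub hS hS' hx, mul_sub, Finset.sum_sub_distrib]

theorem divLower_mul (hS : ∀ μ ν, ContDiffOn ℝ ∞ (S μ ν) Ω) (hφ : DifferentiableAt ℝ φ x)
    (hx : x ∈ Ω) (ν : Fin 4) : g.divLower (fun μ ν y ↦ S μ ν y * φ y) ν x =
      g.divLower S ν x * φ x + ∑ α, (∑ μ, g.up α μ x * S μ ν x) * pd α φ x := by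
  simp only [divLower, g.covDerivLower_mul hS hφ hx, mul_add, Finset.sum_add_distrib,
    Finset.sum_mul, mul_assoc]
  congr 1
  rw [Finset.sum_comm]
  exact Finset.sum_congr rfl fun α _ ↦ Finset.sum_congr rfl fun μ _ ↦ by rw [g.up_symm hx]

theorem divLower_mul_const (hS : ∀ μ ν, ContDiffOn ℝ ∞ (S μ ν) Ω) (c : ℝ) (hx : x ∈ Ω) (ν : Fin 4) :
    g.divLower (fun μ ν y ↦ S μ ν y * c) ν x = g.divLower S ν x * c := by
  simp only [g.divLower_mul hS (differentiableAt_const c) hx, pd_const, mul_zero,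
    Finset.sum_const_zero, add_zero]

/-! ### Divergences of the terms of the field equations -/

theorem contDiffOn_tr (hS : ∀ μ ν, ContDiffOn ℝ ∞ (S μ ν) Ω) : ContDiffOn ℝ ∞ (g.tr S) Ω :=
  ContDiffOn.sum fun μ _ ↦ ContDiffOn.sum fun α _ ↦ (g.contDiffOn_up μ α).mul (hS μ α)

theorem contDiffOn_scalarCurv : ContDiffOn ℝ ∞ g.scalarCurv Ω :=
  g.contDiffOn_tr g.contDiffOn_ricci

theorem contDiffOn_lo_mul (hφ : ContDiffOn ℝ ∞ φ Ω) (μ ν : Fin 4) :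
    ContDiffOn ℝ ∞ (fun y ↦ g.lo μ ν y * φ y) Ω :=
  (g.smooth μ ν).mul hφ

theorem contDiffOn_einstein (μ ν : Fin 4) : ContDiffOn ℝ ∞ (g.einstein μ ν) Ω :=
  (g.contDiffOn_ricci μ ν).sub
    ((contDiffOn_const.mul (g.smooth μ ν)).mul g.contDiffOn_scalarCurv)

theorem divLower_lo_mul (hφ : DifferentiableAt ℝ φ x) (hx : x ∈ Ω) (ν : Fin 4) :
    g.divLower (fun μ ν y ↦ g.lo μ ν y * φ y) ν x = pd ν φ x := by
  have hlo : g.divLower g.lo ν x = 0 := by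
    simp only [divLower, g.covDerivLower_lo hx, mul_zero, Finset.sum_const_zero]
  simp [g.divLower_mul (S := g.lo) g.smooth hφ hx, hlo, g.sum_up_mul_lo hx]

theorem divLower_ricci (hx : x ∈ Ω) (ν : Fin 4) :
    g.divLower g.ricci ν x = (1 / 2) * pd ν g.scalarCurv x :=
  (g.divLower_eq_covDiv g.contDiffOn_ricci hx ν).trans (g.covDiv_ricciMixed hx ν)

theorem divLower_einstein (hx : x ∈ Ω) (ν : Fin 4) : g.divLower g.einstein ν x = 0 := by
  have hR := g.contDiffOn_scalarCurv
  have heq : ∀ y ∈ Ω, ∀ μ ν, g.einstein μ ν y =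
      g.ricci μ ν y - g.lo μ ν y * g.scalarCurv y * (1 / 2) := fun y _ μ ν ↦ by
    rw [einstein]
    ring
  rw [g.divLower_congr heq hx, g.divLower_sub g.contDiffOn_ricci
      (fun μ ν ↦ (g.contDiffOn_lo_mul hR μ ν).mul contDiffOn_const) hx, g.divLower_ricci hx,
    g.divLower_mul_const (g.contDiffOn_lo_mul hR) _ hx,
    g.divLower_lo_mul (differentiableAt_of_smooth hR hx) hx]
  ring

theorem sum_up_mul_einstein (hx : x ∈ Ω) (α ν : Fin 4) : ∑ μ, g.up α μ x * g.einstein μ ν x =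
    g.ricciMixed x α ν - (1 / 2) * g.scalarCurv x * if α = ν then 1 else 0 := by
  rw [← g.sum_up_mul_lo hx, Finset.mul_sum]
  calc ∑ μ, g.up α μ x * g.einstein μ ν x
      = ∑ μ, (g.up α μ x * g.ricci μ ν x
        - (1 / 2) * g.scalarCurv x * (g.up α μ x * g.lo μ ν x)) :=
        Finset.sum_congr rfl fun μ _ ↦ by rw [einstein]; ring
    _ = _ := Finset.sum_sub_distrib ..

/-- The operator `G_{μν} + g_{μν} □ - ∇_μ ∇_ν` of the non-local field equations, applied to `F`. -/
def einsteinOp (F : Coord → ℝ) (μ ν : Fin 4) (x : Coord) : ℝ :=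
  g.einstein μ ν x * F x + g.lo μ ν x * g.box F x - g.hess μ ν F x

/-- The stress tensor `[δ_μ^{(σ} δ_ν^{λ)} - ½ g_{μν} g^{σλ}] ∂_σ F ∂_λ H` of two scalar fields, with
the contractions over `δ` carried out. -/
def gradStress (F H : Coord → ℝ) (μ ν : Fin 4) (x : Coord) : ℝ :=
  (pd μ F x * pd ν H x + pd μ H x * pd ν F x
    - g.lo μ ν x * g.tr (fun σ l y ↦ pd σ F y * pd l H y) x) * (1 / 2)

theorem contDiffOn_pd_mul_pd (hF : ContDiffOn ℝ ∞ F Ω) (hH : ContDiffOn ℝ ∞ H Ω)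
    (μ ν : Fin 4) : ContDiffOn ℝ ∞ (fun y ↦ pd μ F y * pd ν H y) Ω :=
  (contDiffOn_pd μ hF).mul (contDiffOn_pd ν hH)

theorem contDiffOn_einsteinOp (hF : ContDiffOn ℝ ∞ F Ω) (μ ν : Fin 4) :
    ContDiffOn ℝ ∞ (g.einsteinOp F μ ν) Ω :=
  (((g.contDiffOn_einstein μ ν).mul hF).add
    (g.contDiffOn_lo_mul (g.contDiffOn_box hF) μ ν)).sub (g.contDiffOn_hess hF μ ν)

theorem divLower_einsteinOp (hF : ContDiffOn ℝ ∞ F Ω) (hx : x ∈ Ω) (ν : Fin 4) :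
    g.divLower (g.einsteinOp F) ν x = -(1 / 2) * g.scalarCurv x * pd ν F x := by
  have hbox := g.contDiffOn_box hF
  have hEF : ∀ μ ν, ContDiffOn ℝ ∞ (fun y ↦ g.einstein μ ν y * F y) Ω :=
    fun μ ν ↦ (g.contDiffOn_einstein μ ν).mul hF
  have hdivEF : g.divLower (fun μ ν y ↦ g.einstein μ ν y * F y) ν x =
      ∑ α, g.ricciMixed x α ν * pd α F x - (1 / 2) * g.scalarCurv x * pd ν F x := by
    simp [g.divLower_mul g.contDiffOn_einstein (differentiableAt_of_smooth hF hx) hx,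
      g.divLower_einstein hx, g.sum_up_mul_einstein hx, sub_mul]
  calc g.divLower (g.einsteinOp F) ν x
      = g.divLower (fun μ ν y ↦ g.einstein μ ν y * F y) ν x
        + g.divLower (fun μ ν y ↦ g.lo μ ν y * g.box F y) ν x
        - g.divLower (fun μ ν ↦ g.hess μ ν F) ν x := by
        rw [← g.divLower_add hEF (g.contDiffOn_lo_mul hbox) hx, ← g.divLower_sub
          (fun μ ν ↦ (hEF μ ν).add (g.contDiffOn_lo_mul hbox μ ν)) (g.contDiffOn_hess hF) hx]
        rfl
    _ = -(1 / 2) * g.scalarCurv x * pd ν F x := by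
        rw [hdivEF, g.divLower_lo_mul (differentiableAt_of_smooth hbox hx) hx,
          g.divLower_hess hF hx]
        ring

theorem divLower_pd_mul_pd (hF : ContDiffOn ℝ ∞ F Ω) (hH : ContDiffOn ℝ ∞ H Ω) (hx : x ∈ Ω)
    (ν : Fin 4) : g.divLower (fun μ ν y ↦ pd μ F y * pd ν H y) ν x =
      g.box F x * pd ν H x + g.tr (fun μ α y ↦ pd μ F y * g.hess α ν H y) x := by
  simp only [divLower, g.covDerivLower_pd_mul_pd hF hH hx, g.box_eq_tr_hess hF hx, tr, mul_add,
    Finset.sum_add_distrib, Finset.sum_mul, g.hess_symm hF hx, mul_assoc]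

theorem pd_tr_pd_mul_pd (hF : ContDiffOn ℝ ∞ F Ω) (hH : ContDiffOn ℝ ∞ H Ω) (hx : x ∈ Ω)
    (ν : Fin 4) : pd ν (g.tr fun μ α y ↦ pd μ F y * pd α H y) x =
      g.tr (fun μ α y ↦ pd μ F y * g.hess α ν H y) x
        + g.tr (fun μ α y ↦ pd μ H y * g.hess α ν F y) x := by
  rw [g.pd_tr (contDiffOn_pd_mul_pd hF hH) hx]
  simp only [tr, g.covDerivLower_pd_mul_pd hF hH hx, mul_add, Finset.sum_add_distrib]
  rw [add_comm]
  congr 1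
  · simp only [g.hess_symm hH hx]
  · rw [Finset.sum_comm]
    refine Finset.sum_congr rfl fun α _ ↦ Finset.sum_congr rfl fun μ _ ↦ ?_
    rw [g.up_symm hx, g.hess_symm hF hx, mul_comm (g.hess _ _ _ _)]

theorem divLower_gradStress (hF : ContDiffOn ℝ ∞ F Ω) (hH : ContDiffOn ℝ ∞ H Ω) (hx : x ∈ Ω)
    (ν : Fin 4) : g.divLower (g.gradStress F H) ν x =
      (1 / 2) * (g.box F x * pd ν H x + g.box H x * pd ν F x) := by
  have hFH := contDiffOn_pd_mul_pd hF hH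
  have hHF := contDiffOn_pd_mul_pd hH hF
  have htr := g.contDiffOn_tr hFH
  have hsum : ∀ μ ν, ContDiffOn ℝ ∞ (fun y ↦ pd μ F y * pd ν H y + pd μ H y * pd ν F y) Ω :=
    fun μ ν ↦ (hFH μ ν).add (hHF μ ν)
  have hlo := g.contDiffOn_lo_mul htr
  calc g.divLower (g.gradStress F H) ν x
      = (g.divLower (fun μ ν y ↦ pd μ F y * pd ν H y) ν x
        + g.divLower (fun μ ν y ↦ pd μ H y * pd ν F y) ν x
        - g.divLower (fun μ ν y ↦ g.lo μ ν y * g.tr (fun σ l y ↦ pd σ F y * pd l H y) y) ν x)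
        * (1 / 2) := by
        rw [← g.divLower_add hFH hHF hx, ← g.divLower_sub hsum hlo hx,
          ← g.divLower_mul_const (fun μ ν ↦ (hsum μ ν).sub (hlo μ ν)) _ hx]
        rfl
    _ = (1 / 2) * (g.box F x * pd ν H x + g.box H x * pd ν F x) := by
        rw [g.divLower_pd_mul_pd hF hH hx, g.divLower_pd_mul_pd hH hF hx,
          g.divLower_lo_mul (differentiableAt_of_smooth htr hx) hx, g.pd_tr_pd_mul_pd hF hH hx]
        ring

theorem contDiffOn_gradStress (hF : ContDiffOn ℝ ∞ F Ω) (hH : ContDiffOn ℝ ∞ H Ω) (μ ν : Fin 4) :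
    ContDiffOn ℝ ∞ (g.gradStress F H μ ν) Ω :=
  (((contDiffOn_pd_mul_pd hF hH μ ν).add (contDiffOn_pd_mul_pd hH hF μ ν)).sub
    (g.contDiffOn_lo_mul (g.contDiffOn_tr (contDiffOn_pd_mul_pd hF hH)) μ ν)).mul contDiffOn_const

theorem deltaG_eq (f : ℝ → ℝ) (U V : Coord → ℝ) (μ ν : Fin 4) (x : Coord) :
    g.deltaG f U V μ ν x =
      g.einsteinOp (fun y ↦ f (U y) + V y) μ ν x + g.gradStress V U μ ν x := by
  have hsymm : ∑ σ, ∑ l, (1 / 2) * ((if σ = μ then 1 else 0) * (if l = ν then 1 else 0)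
      + (if l = μ then 1 else 0) * (if σ = ν then 1 else 0)) * pd σ V x * pd l U x =
      (1 / 2) * (pd μ V x * pd ν U x + pd μ U x * pd ν V x) := by
    simp [mul_add, add_mul, Finset.sum_add_distrib, mul_assoc, mul_comm (pd μ U x)]
  have htr : ∑ σ, ∑ l, (1 / 2) * g.lo μ ν x * g.up σ l x * pd σ V x * pd l U x =
      (1 / 2) * g.lo μ ν x * g.tr (fun σ l y ↦ pd σ V y * pd l U y) x := by
    simp only [tr, Finset.mul_sum, mul_assoc]
  simp only [deltaG, einsteinOp, gradStress, sub_mul, Finset.sum_sub_distrib, hsymm, htr]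
  ring

end LorentzMetric

/-! ### Inverting `□⁻¹` -/

theorem contDiff_of_tsupport_subset {n : ℕ∞ω} {F : Coord → ℝ} (hF : ContDiffOn ℝ n F Ω)
    (hs : tsupport F ⊆ Ω) : ContDiff ℝ n F := by
  refine contDiff_iff_contDiffAt.2 fun x ↦ ?_
  by_cases hx : x ∈ tsupport F
  · exact hF.contDiffAt (Ω.isOpen.mem_nhds (hs hx))
  · exact contDiffAt_const.congr_of_eventuallyEq (notMem_tsupport_iff_eventuallyEq.1 hx)

theorem integrable_mul_testFunction {F : Coord → ℝ} (hF : ContinuousOn F Ω) (h : 𝓓(Ω, ℝ)) :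
    Integrable fun x ↦ F x * h x :=
  ((hF.mul h.continuous.continuousOn).continuous_of_tsupport_subset Ω.isOpen
    (tsupport_mul_subset_right.trans h.tsupport_subset)).integrable_of_hasCompactSupport
      h.hasCompactSupport.mul_left

theorem setIntegral_mul_testFunction (F : Coord → ℝ) (h : 𝓓(Ω, ℝ)) :
    ∫ x in Ω, F x * h x = ∫ x, F x * h x :=
  setIntegral_eq_integral_of_forall_compl_eq_zero fun x hx ↦ by
    rw [image_eq_zero_of_notMem_tsupport fun hxh ↦ hx (h.tsupport_subset hxh), mul_zero]

theorem integrable_pd {W : Coord → ℝ} (hW : ContDiff ℝ 1 W) (hc : HasCompactSupport W)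
    (σ : Fin 4) : Integrable (pd σ W) :=
  ((hW.continuous_fderiv one_ne_zero).clm_apply
    continuous_const).integrable_of_hasCompactSupport (hc.fderiv_apply ℝ _)

theorem integral_pd_eq_zero {W : Coord → ℝ} (hW : ContDiff ℝ 1 W) (hc : HasCompactSupport W)
    (σ : Fin 4) : ∫ x, pd σ W x = 0 := by
  have h := integral_mul_fderiv_eq_neg_fderiv_mul_of_integrable (μ := volume) (𝕜 := ℝ)
    (f := fun _ : Coord ↦ (1 : ℝ)) (g := W) (v := Pi.single σ 1) (by simp)
    (by simp only [one_mul]; exact integrable_pd hW hc σ)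
    (by simpa using hW.continuous.integrable_of_hasCompactSupport hc)
    (fun x _ ↦ differentiableAt_const _) (fun x _ ↦ hW.differentiable one_ne_zero x)
  simpa [pd] using h

theorem eq_of_setIntegral_mul_testFunction_eq {A B : Coord → ℝ} (hA : ContinuousOn A Ω)
    (hB : ContinuousOn B Ω)
    (h : ∀ φ : 𝓓(Ω, ℝ), ∫ x in Ω, A x * φ x = ∫ x in Ω, B x * φ x) (hx : x ∈ Ω) :
    A x = B x := by
  have hae : ∀ᵐ y, y ∈ (Ω : Set Coord) → A y - B y = 0 := by
    refine Ω.isOpen.ae_eq_zero_of_integral_contDiff_smul_eq_zero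
      ((hA.sub hB).locallyIntegrableOn Ω.isOpen.measurableSet) fun φ hφ hφc hφs ↦ ?_
    let φ' : 𝓓(Ω, ℝ) := ⟨φ, hφ, hφc, hφs⟩
    calc ∫ y, φ y • (A y - B y) = ∫ y, (A y * φ' y - B y * φ' y) :=
          integral_congr_ae (.of_forall fun y ↦ (mul_comm _ _).trans (sub_mul _ _ _))
      _ = (∫ y, A y * φ' y) - ∫ y, B y * φ' y := integral_sub
          (integrable_mul_testFunction hA φ') (integrable_mul_testFunction hB φ')
      _ = 0 := by rw [← setIntegral_mul_testFunction, ← setIntegral_mul_testFunction, h, sub_self]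
  exact Measure.eqOn_open_of_ae_eq ((ae_restrict_iff' Ω.isOpen.measurableSet).2
    (hae.mono fun y hy hyΩ ↦ sub_eq_zero.1 (hy hyΩ))) Ω.isOpen hA hB hx

namespace LorentzMetric

variable (g : LorentzMetric Ω) {F H : Coord → ℝ}

/-- The vector density `√(-g) g^{σλ} ∂_λ F`, whose coordinate divergence is `√(-g) □F`. -/
def gradDensity (F : Coord → ℝ) (σ : Fin 4) (x : Coord) : ℝ :=
  g.sqrtNegDet x * ∑ l, g.up σ l x * pd l F x

theorem contDiffOn_gradDensity (hF : ContDiffOn ℝ ∞ F Ω) (σ : Fin 4) :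
    ContDiffOn ℝ ∞ (g.gradDensity F σ) Ω :=
  g.contDiffOn_sqrtNegDet.mul
    (ContDiffOn.sum fun l _ ↦ (g.contDiffOn_up σ l).mul (contDiffOn_pd l hF))

theorem sum_pd_gradDensity (F : Coord → ℝ) (hx : x ∈ Ω) :
    ∑ σ, pd σ (g.gradDensity F σ) x = g.sqrtNegDet x * g.box F x :=
  (mul_inv_cancel_left₀ (g.sqrtNegDet_pos hx).ne' _).symm

theorem sum_pd_mul_gradDensity_comm (F H : Coord → ℝ) (hx : x ∈ Ω) :
    ∑ σ, pd σ F x * g.gradDensity H σ x = ∑ σ, pd σ H x * g.gradDensity F σ x := by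
  simp only [gradDensity, Finset.mul_sum]
  rw [Finset.sum_comm]
  refine Finset.sum_congr rfl fun σ _ ↦ Finset.sum_congr rfl fun l _ ↦ ?_
  rw [g.up_symm hx]
  ring

/-- The current `√(-g) (F ∇^σ H - H ∇^σ F)` of Green's second identity. -/
def greenCurrent (F H : Coord → ℝ) (σ : Fin 4) (x : Coord) : ℝ :=
  F x * g.gradDensity H σ x - H x * g.gradDensity F σ x

theorem contDiffOn_greenCurrent (hF : ContDiffOn ℝ ∞ F Ω) (hH : ContDiffOn ℝ ∞ H Ω)
    (σ : Fin 4) : ContDiffOn ℝ ∞ (g.greenCurrent F H σ) Ω :=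
  (hF.mul (g.contDiffOn_gradDensity hH σ)).sub (hH.mul (g.contDiffOn_gradDensity hF σ))

theorem sum_pd_greenCurrent (hF : ContDiffOn ℝ ∞ F Ω) (hH : ContDiffOn ℝ ∞ H Ω) (hx : x ∈ Ω) :
    ∑ σ, pd σ (g.greenCurrent F H σ) x =
      F x * (g.sqrtNegDet x * g.box H x) - g.sqrtNegDet x * g.box F x * H x := by
  have hpd (σ : Fin 4) : pd σ (g.greenCurrent F H σ) x =
      pd σ F x * g.gradDensity H σ x + F x * pd σ (g.gradDensity H σ) x
        - (pd σ H x * g.gradDensity F σ x + H x * pd σ (g.gradDensity F σ) x) := by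
    have hFd := differentiableAt_of_smooth hF hx
    have hHd := differentiableAt_of_smooth hH hx
    have hgF := differentiableAt_of_smooth (g.contDiffOn_gradDensity hF σ) hx
    have hgH := differentiableAt_of_smooth (g.contDiffOn_gradDensity hH σ) hx
    rw [← pd_mul hFd hgH, ← pd_mul hHd hgF, ← pd_sub (hFd.fun_mul hgH) (hHd.fun_mul hgF)]
    rfl
  simp only [hpd, Finset.sum_sub_distrib, Finset.sum_add_distrib, ← Finset.mul_sum,
    g.sum_pd_mul_gradDensity_comm F H hx, g.sum_pd_gradDensity _ hx]
  ring

theorem tsupport_greenCurrent_subset (F H : Coord → ℝ) (σ : Fin 4) :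
    tsupport (g.greenCurrent F H σ) ⊆ tsupport H := by
  refine closure_minimal (fun x hx ↦ ?_) (isClosed_tsupport H)
  by_contra hxH
  have hH := notMem_tsupport_iff_eventuallyEq.1 hxH
  refine hx ?_
  simp [greenCurrent, gradDensity, pd_eq_zero hH, hH.eq_of_nhds]

theorem setIntegral_mul_boxTest (hF : ContDiffOn ℝ ∞ F Ω) (h : 𝓓(Ω, ℝ)) :
    ∫ x in Ω, F x * g.boxTest h x = ∫ x in Ω, g.sqrtNegDet x * g.box F x * h x := by
  have hsupp (σ : Fin 4) := g.tsupport_greenCurrent_subset F h σ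
  have hsmooth (σ : Fin 4) : ContDiff ℝ 1 (g.greenCurrent F h σ) :=
    (contDiff_of_tsupport_subset (g.contDiffOn_greenCurrent hF h.contDiff.contDiffOn σ)
      ((hsupp σ).trans h.tsupport_subset)).of_le (by simp)
  have hcompact (σ : Fin 4) : HasCompactSupport (g.greenCurrent F h σ) :=
    h.hasCompactSupport.of_isClosed_subset (isClosed_tsupport _) (hsupp σ)
  have hpd (σ : Fin 4) : ∫ x in Ω, pd σ (g.greenCurrent F h σ) x = 0 := by
    rw [setIntegral_eq_integral_of_forall_compl_eq_zero fun x hx ↦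
      pd_eq_zero (notMem_tsupport_iff_eventuallyEq.1 fun hxW ↦
        hx (h.tsupport_subset (hsupp σ hxW))), integral_pd_eq_zero (hsmooth σ) (hcompact σ)]
  have hbox : ContinuousOn (fun x ↦ g.sqrtNegDet x * g.box F x) Ω :=
    g.contDiffOn_sqrtNegDet.continuousOn.mul (g.contDiffOn_box hF).continuousOn
  rw [← sub_eq_zero, ← integral_sub
    (integrable_mul_testFunction hF.continuousOn (g.boxTest h)).integrableOn
    (integrable_mul_testFunction hbox h).integrableOn]
  calc ∫ x in Ω, (F x * g.boxTest h x - g.sqrtNegDet x * g.box F x * h x)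
      = ∫ x in Ω, ∑ σ, pd σ (g.greenCurrent F h σ) x :=
        setIntegral_congr_fun Ω.isOpen.measurableSet fun x hx ↦
          (g.sum_pd_greenCurrent hF h.contDiff.contDiffOn hx).symm
    _ = 0 := by
        rw [integral_finsetSum _ fun σ _ ↦ (integrable_pd (hsmooth σ) (hcompact σ) σ).integrableOn]
        exact Finset.sum_eq_zero fun σ _ ↦ hpd σ

variable {g} in
theorem IsBoxInv.box_eq {G : Coord → 𝓓'(Ω, ℝ)} {p u : Coord → ℝ} (hu : g.IsBoxInv G p u)
    (hG : g.IsRetardedGreen G) (hp : ContinuousOn p Ω) (hx : x ∈ Ω) : g.box u x = p x := by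
  have hs := g.contDiffOn_sqrtNegDet.continuousOn
  have hb := (g.contDiffOn_box hu.smooth).continuousOn
  have hweak (h : 𝓓(Ω, ℝ)) :
      ∫ y in Ω, g.sqrtNegDet y * g.box u y * h y = ∫ y in Ω, g.sqrtNegDet y * p y * h y := by
    rw [← g.setIntegral_mul_boxTest hu.smooth, hu.eq_integral]
    refine setIntegral_congr_fun Ω.isOpen.measurableSet fun y hy ↦ ?_
    simp only [hG.green y hy h]
    exact mul_right_comm _ _ _
  exact mul_left_cancel₀ (g.sqrtNegDet_pos hx).ne'
    (eq_of_setIntegral_mul_testFunction_eq (hs.mul hb) (hs.mul hp) hweak hx)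

/-! ### The non-local correction -/

variable {f : ℝ → ℝ} {U V : Coord → ℝ}

theorem contDiffOn_deltaG (hfU : ContDiffOn ℝ ∞ (fun y ↦ f (U y)) Ω)
    (hU : ContDiffOn ℝ ∞ U Ω) (hV : ContDiffOn ℝ ∞ V Ω) (μ ν : Fin 4) :
    ContDiffOn ℝ ∞ (g.deltaG f U V μ ν) Ω :=
  ((g.contDiffOn_einsteinOp (hfU.add hV) μ ν).add (g.contDiffOn_gradStress hV hU μ ν)).congr
    fun y _ ↦ g.deltaG_eq f U V μ ν y

theorem divLower_deltaG (hfU : ContDiffOn ℝ ∞ (fun y ↦ f (U y)) Ω)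
    (hU : ContDiffOn ℝ ∞ U Ω) (hV : ContDiffOn ℝ ∞ V Ω) (hx : x ∈ Ω) (ν : Fin 4) :
    g.divLower (g.deltaG f U V) ν x =
      (1 / 2) * ((g.box U x - g.scalarCurv x) * pd ν V x + g.box V x * pd ν U x
        - g.scalarCurv x * pd ν (fun y ↦ f (U y)) x) := by
  have hF := hfU.add hV
  rw [g.divLower_congr (fun y _ μ ν ↦ g.deltaG_eq f U V μ ν y) hx,
    g.divLower_add (g.contDiffOn_einsteinOp hF) (g.contDiffOn_gradStress hV hU) hx,
    g.divLower_einsteinOp hF hx, g.divLower_gradStress hV hU hx,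
    pd_add (differentiableAt_of_smooth hfU hx) (differentiableAt_of_smooth hV hx)]
  ring

theorem divUpper_raise_eq_zero {S T : Fin 4 → Fin 4 → Coord → ℝ} {χ : ℝ}
    (hS : ∀ μ ν, ContDiffOn ℝ ∞ (S μ ν) Ω) (hdiv : ∀ y ∈ Ω, ∀ ν, g.divLower S ν y = 0)
    (hχ : χ ≠ 0) (hST : ∀ y ∈ Ω, ∀ μ ν, S μ ν y = χ * T μ ν y) (hx : x ∈ Ω) (ν : Fin 4) :
    g.divUpper (g.raise T) ν x = 0 := by
  have hT : ∀ y ∈ Ω, ∀ μ ν, T μ ν y = S μ ν y * χ⁻¹ := fun y hy μ ν ↦ by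
    rw [hST y hy, mul_comm χ, mul_inv_cancel_right₀ hχ]
  have hTsmooth (μ ν : Fin 4) : ContDiffOn ℝ ∞ (T μ ν) Ω :=
    ((hS μ ν).mul contDiffOn_const).congr fun y hy ↦ hT y hy μ ν
  have hdivT (β : Fin 4) : g.divLower T β x = 0 := by
    rw [g.divLower_congr hT hx, g.divLower_mul_const hS _ hx, hdiv x hx, zero_mul]
  simp only [g.divUpper_raise hTsmooth hx, hdivT, zero_mul, Finset.sum_const_zero]

end LorentzMetric

end

end NonlocalGravity

open NonlocalGravity in
theorem mainTheorem1_general {Ω : Opens Coord} (g : LorentzMetric Ω) {f : ℝ → ℝ}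
    {U V : Coord → ℝ} (hU : ContDiffOn ℝ ∞ U Ω) (hV : ContDiffOn ℝ ∞ V Ω)
    (hf : ∀ x ∈ Ω, ContDiffAt ℝ ∞ f (U x)) (hboxU : ∀ x ∈ Ω, g.box U x = g.scalarCurv x)
    (hboxV : ∀ x ∈ Ω, g.box V x = g.scalarCurv x * deriv f (U x)) :
    (∀ x ∈ Ω, ∀ ν : Fin 4,
      g.divLower (fun μ ν y ↦ g.einstein μ ν y + g.deltaG f U V μ ν y) ν x = 0) ∧
    (∀ (χ : ℝ) (T : Fin 4 → Fin 4 → Coord → ℝ), χ ≠ 0 →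
      (∀ x ∈ Ω, ∀ μ ν : Fin 4,
        g.einstein μ ν x + g.deltaG f U V μ ν x = χ * T μ ν x) →
      ∀ x ∈ Ω, ∀ ν : Fin 4, g.divUpper (g.raise T) ν x = 0) := by
  have hfU : ContDiffOn ℝ ∞ (fun y ↦ f (U y)) Ω := fun x hx ↦
    (hf x hx).comp_contDiffWithinAt x (hU x hx)
  have hdiv : ∀ x ∈ Ω, ∀ ν : Fin 4,
      g.divLower (fun μ ν y ↦ g.einstein μ ν y + g.deltaG f U V μ ν y) ν x = 0 := by
    intro x hx ν
    rw [g.divLower_add g.contDiffOn_einstein (g.contDiffOn_deltaG hfU hU hV) hx,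
      g.divLower_einstein hx, g.divLower_deltaG hfU hU hV hx, hboxU x hx, hboxV x hx,
      pd_comp ((hf x hx).differentiableAt (by simp)) (differentiableAt_of_smooth hU hx)]
    ring
  exact ⟨hdiv, fun χ T hχ hT x hx ν ↦ g.divUpper_raise_eq_zero (fun μ ν ↦
    (g.contDiffOn_einstein μ ν).add (g.contDiffOn_deltaG hfU hU hV μ ν)) hdiv hχ hT hx ν⟩

theorem mainTheorem1
    (Ω : Opens NonlocalGravity.Coord) (g : NonlocalGravity.LorentzMetric Ω)
    (G : NonlocalGravity.Coord → 𝓓'(Ω, ℝ)) (hG : g.IsRetardedGreen G)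
    (f : ℝ → ℝ) (U V : NonlocalGravity.Coord → ℝ)
    (hU : g.IsBoxInv G g.scalarCurv U)
    (hf : AnalyticOnNhd ℝ f (U '' Ω))
    (hV : g.IsBoxInv G (fun x => g.scalarCurv x * deriv f (U x)) V) :
    (∀ x ∈ Ω, ∀ ν : Fin 4,
      g.divLower (fun μ ν y => g.einstein μ ν y + g.deltaG f U V μ ν y) ν x = 0) ∧
    (∀ (χ : ℝ) (T : Fin 4 → Fin 4 → NonlocalGravity.Coord → ℝ), χ ≠ 0 →
      (∀ x ∈ Ω, ∀ μ ν : Fin 4,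
        g.einstein μ ν x + g.deltaG f U V μ ν x = χ * T μ ν x) →
      ∀ x ∈ Ω, ∀ ν : Fin 4, g.divUpper (g.raise T) ν x = 0) := by
  have hR := g.contDiffOn_scalarCurv.continuousOn
  have hRf : ContinuousOn (fun x ↦ g.scalarCurv x * deriv f (U x)) Ω :=
    hR.mul (hf.deriv.continuousOn.comp hU.smooth.continuousOn (Set.mapsTo_image U Ω))
  exact mainTheorem1_general g hU.smooth hV.smooth
    (fun x hx ↦ (hf _ (Set.mem_image_of_mem U hx)).contDiffAt)
    (fun _ ↦ hU.box_eq hG hR) (fun _ ↦ hV.box_eq hG hRf)
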